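/- All graphs are finite and simple; a forest is a graph without cycles (equivalently, all its connected components are trees). For a graph $G$ with vertex set $V$, let $\mathrm{Adj}(G)\in M_V(\{0,1\})$ be its adjacency matrix. A \emph{magic unitary} over a unital $*$-algebra $A$ is a square matrix $U=(u_{ij})$ over $A$ (rows and columns may be labelled by two different finite sets of the same cardinality) such that $u_{ij}^*=u_{ij}=u_{ij}^2$, every row and every column of $U$ sums to $1$, and two distinct entries in the same row or in the same column have product $0$. The \emph{quantum automorphism group} $\mathrm{Qu}(G)$ is the pair $(\mathcal O(\mathrm{Qu}(G)),p)$, where $\mathcal O(\mathrm{Qu}(G))$ is the universal unital complex $*$-algebra generated by the entries of a matrix $p=(p_{ij})_{i,j\in V}$, subject to the relations that $p$ is a magic unitary and $\mathrm{Adj}(G)\,p=p\,\mathrm{Adj}(G)$; it carries the comultiplication $\Delta(p_{ij})=\sum_{k\in V}p_{ik}\otimes p_{kj}$. It is \emph{trivial} if it is isomorphic, as a quantum group (that is, by a $*$-isomorphism compatible with the comultiplications), to the trivial quantum group with algebra of coefficients $\mathbb C$. The graph $G$ \emph{has quantum symmetry} if $\mathcal O(\mathrm{Qu}(G))$ is not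 commutative. It is \emph{asymmetric} if its automorphism group $\mathrm{Aut}(G)$ is trivial. It satisfies \emph{Schmidt's criterion} if it has two nontrivial automorphisms $f,g$ whose supports $\{x\in V: f(x)\neq x\}$ and $\{x\in V: g(x)\neq x\}$ are disjoint. Two graphs $G,H$ are \emph{quantum isomorphic} if there are a nonzero unital $C^*$-algebra $X$ and a magic unitary $P$ over $X$, with rows labelled by $V(H)$ and columns by $V(G)$, such that $P\,\mathrm{Adj}(G)=\mathrm{Adj}(H)\,P$. A class $\mathcal F$ of graphs is \emph{tractable} if (QA) for every $G\in\mathcal F$, $\mathrm{Aut}(G)$ is trivial if and only if $\mathrm{Qu}(G)$ is trivial; (QI) for all $G,H\in\mathcal F$, $G$ and $H$ are quantum isomorphic if and only if they are isomorphic; (SA) for every $G\in\mathcal F$, $G$ has quantum symmetry if and only if $G$ satisfies Schmidt's criterion. \textbf{Theorem.} The class of forests is tractable. In other words: a forest is asymmetric if and only if its quantum automorphism group is trivial; two forests are quantum isomorphic if and only if they are isomorphic; and a forest has quantum symmetry if and only if it satisfies Schmidt's criterion. -/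

import Mathlib

universe u v w

noncomputable section

open scoped TensorProduct

namespace QuantumGraph

/-! ## `*`-polynomials in noncommuting variables -/

/-- Complex `*`-polynomials in noncommuting variables `x s` and `x s ^*`, for `s : σ`:
the free unital `*`-algebra on `σ`. The summand `Sum.inl` carries the variables, and `Sum.inr`
their adjoints. -/
def StarPolynomial (σ : Type u) : Type u := FreeAlgebra ℂ (σ ⊕ σ)

namespace StarPolynomial

variable {σ : Type u}

instance : Ring (StarPolynomial σ) := inferInstanceAs (Ring (FreeAlgebra ℂ (σ ⊕ σ)))

instance : Algebra ℂ (StarPolynomial σ) := inferInstanceAs (Algebra ℂ (FreeAlgebra ℂ (σ ⊕ σ)))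

/-- A variable or a formal adjoint of a variable. -/
def gen (s : σ ⊕ σ) : StarPolynomial σ := FreeAlgebra.ι ℂ s

/-- The variable `x s`. -/
def X (s : σ) : StarPolynomial σ := gen (Sum.inl s)

/-- The complex structure on the opposite ring, twisted by complex conjugation. It turns
conjugate-linear antihomomorphisms into algebra homomorphisms. -/
abbrev conjOpAlgebra (A : Type u) [Ring A] [Algebra ℂ A] : Algebra ℂ Aᵐᵒᵖ :=
  RingHom.toAlgebra' ((algebraMap ℂ Aᵐᵒᵖ).comp (starRingEnd ℂ))
    (fun c x => Algebra.commutes (starRingEnd ℂ c) x)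

/-- The adjoint operation as a ring homomorphism to the opposite ring: it exchanges `x s` and
`x s ^*`, reverses products, and conjugates scalars. -/
def starHom : StarPolynomial σ →+* (StarPolynomial σ)ᵐᵒᵖ :=
  letI := conjOpAlgebra (StarPolynomial σ)
  (FreeAlgebra.lift ℂ (fun s : σ ⊕ σ => MulOpposite.op (gen s.swap))).toRingHom

theorem starHom_gen (s : σ ⊕ σ) : starHom (gen s) = MulOpposite.op (gen s.swap) := by
  let := conjOpAlgebra (StarPolynomial σ)
  exact FreeAlgebra.lift_ι_apply (R := ℂ) (fun s : σ ⊕ σ => MulOpposite.op (gen s.swap)) s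

theorem starHom_algebraMap (c : ℂ) : starHom (algebraMap ℂ (StarPolynomial σ) c) =
    MulOpposite.op (algebraMap ℂ (StarPolynomial σ) (star c)) := by
  let := conjOpAlgebra (StarPolynomial σ)
  exact (FreeAlgebra.lift ℂ (fun s : σ ⊕ σ => MulOpposite.op (gen s.swap))).commutes c

theorem starHom_starHom (x : StarPolynomial σ) :
    (starHom (starHom x).unop).unop = x := by
  refine FreeAlgebra.induction (R := ℂ) (X := σ ⊕ σ)
    (motive := fun x : StarPolynomial σ => (starHom (starHom x).unop).unop = x)
    ?_ ?_ ?_ ?_ x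
  · intro c
    change (starHom (starHom (algebraMap ℂ (StarPolynomial σ) c)).unop).unop = _
    rw [starHom_algebraMap, MulOpposite.unop_op, starHom_algebraMap, star_star]
    rfl
  · intro s
    change (starHom (starHom (gen s)).unop).unop = _
    rw [starHom_gen, MulOpposite.unop_op, starHom_gen, Sum.swap_swap]
    rfl
  · intro a b ha hb
    have h : ∀ p q : StarPolynomial σ, (starHom (starHom p).unop).unop = p →
        (starHom (starHom q).unop).unop = q →
        (starHom (starHom (p * q)).unop).unop = p * q := by
      intro p q hp hq
      rw [map_mul, MulOpposite.unop_mul, map_mul, MulOpposite.unop_mul, hp, hq]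
    exact h a b ha hb
  · intro a b ha hb
    have h : ∀ p q : StarPolynomial σ, (starHom (starHom p).unop).unop = p →
        (starHom (starHom q).unop).unop = q →
        (starHom (starHom (p + q)).unop).unop = p + q := by
      intro p q hp hq
      rw [map_add, MulOpposite.unop_add, map_add, MulOpposite.unop_add, hp, hq]
    exact h a b ha hb

instance : StarRing (StarPolynomial σ) where
  star x := (starHom x).unop
  star_involutive := starHom_starHom
  star_mul x y := by rw [map_mul, MulOpposite.unop_mul]
  star_add x y := by rw [map_add, MulOpposite.unop_add]

theorem star_def (x : StarPolynomial σ) : star x = (starHom x).unop := rfl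

theorem star_X (s : σ) : star (X s) = gen (Sum.inr s) := by
  rw [star_def, X, starHom_gen]; rfl

theorem star_gen (s : σ ⊕ σ) : star (gen s) = gen s.swap := by
  rw [star_def, starHom_gen]; rfl

theorem star_algebraMap (c : ℂ) : star (algebraMap ℂ (StarPolynomial σ) c) =
    algebraMap ℂ (StarPolynomial σ) (star c) := by
  rw [star_def, starHom_algebraMap]; rfl

instance : StarModule ℂ (StarPolynomial σ) where
  star_smul c x := by
    rw [Algebra.smul_def, star_mul, star_algebraMap, Algebra.smul_def, Algebra.commutes]

/-- Evaluation of `*`-polynomials at a family of elements of a unital `*`-algebra. -/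
def eval {B : Type v} [Ring B] [StarRing B] [Algebra ℂ B] (b : σ → B) :
    StarPolynomial σ →ₐ[ℂ] B :=
  FreeAlgebra.lift ℂ (Sum.elim b fun s => star (b s))

section eval

variable {B : Type v} [Ring B] [StarRing B] [Algebra ℂ B]

theorem eval_gen (b : σ → B) (s : σ ⊕ σ) :
    eval b (gen s) = Sum.elim b (fun s => star (b s)) s :=
  FreeAlgebra.lift_ι_apply (R := ℂ) (Sum.elim b fun s => star (b s)) s

theorem eval_X (b : σ → B) (s : σ) : eval b (X s) = b s := eval_gen b _

theorem eval_star [StarModule ℂ B] (b : σ → B) (x : StarPolynomial σ) :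
    eval b (star x) = star (eval b x) := by
  refine FreeAlgebra.induction (R := ℂ) (X := σ ⊕ σ)
    (motive := fun x : StarPolynomial σ => eval b (star x) = star (eval b x)) ?_ ?_ ?_ ?_ x
  · intro c
    change eval b (star (algebraMap ℂ (StarPolynomial σ) c)) =
      star (eval b (algebraMap ℂ (StarPolynomial σ) c))
    rw [star_algebraMap, AlgHom.commutes, AlgHom.commutes, algebraMap_star_comm]
  · intro s
    change eval b (star (gen s)) = star (eval b (gen s))
    rw [star_gen, eval_gen, eval_gen]
    cases s <;> simp
  · intro a c ha hc
    have h : ∀ p q : StarPolynomial σ, eval b (star p) = star (eval b p) →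
        eval b (star q) = star (eval b q) → eval b (star (p * q)) = star (eval b (p * q)) := by
      intro p q hp hq
      rw [star_mul, map_mul, map_mul, star_mul, hp, hq]
    exact h a c ha hc
  · intro a c ha hc
    have h : ∀ p q : StarPolynomial σ, eval b (star p) = star (eval b p) →
        eval b (star q) = star (eval b q) → eval b (star (p + q)) = star (eval b (p + q)) := by
      intro p q hp hq
      rw [star_add, map_add, map_add, star_add, hp, hq]
    exact h a c ha hc

end eval

end StarPolynomial

/-! ## Universal unital `*`-algebras -/

/-- Closure of a set of relations `p = q` between `*`-polynomials under taking adjoints. -/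
inductive StarClosure {σ : Type u} (R : StarPolynomial σ → StarPolynomial σ → Prop) :
    StarPolynomial σ → StarPolynomial σ → Prop
  | of {p q : StarPolynomial σ} : R p q → StarClosure R p q
  | star {p q : StarPolynomial σ} : R p q → StarClosure R (star p) (star q)

theorem StarClosure.star_mem {σ : Type u} {R : StarPolynomial σ → StarPolynomial σ → Prop}
    {p q : StarPolynomial σ} (h : StarClosure R p q) : StarClosure R (Star.star p) (Star.star q) := by
  cases h with
  | of h => exact .star h
  | star h => rw [star_star, star_star]; exact .of h

/-- The universal unital complex `*`-algebra generated by elements indexed by `σ`, subject to the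
relations `p = q` for all `*`-polynomials `p`, `q` with `R p q`. -/
def UniversalStarAlgebra {σ : Type u} (R : StarPolynomial σ → StarPolynomial σ → Prop) : Type u :=
  RingQuot (StarClosure R)

namespace UniversalStarAlgebra

variable {σ : Type u} {R : StarPolynomial σ → StarPolynomial σ → Prop}

instance : Ring (UniversalStarAlgebra R) := inferInstanceAs (Ring (RingQuot (StarClosure R)))

instance : Algebra ℂ (UniversalStarAlgebra R) :=
  inferInstanceAs (Algebra ℂ (RingQuot (StarClosure R)))

variable (R) in
/-- The quotient map. -/
def mk : StarPolynomial σ →ₐ[ℂ] UniversalStarAlgebra R := RingQuot.mkAlgHom ℂ (StarClosure R)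

variable (R) in
/-- The generators. -/
def gen (s : σ) : UniversalStarAlgebra R := mk R (StarPolynomial.X s)

theorem mk_surjective : Function.Surjective (mk R) :=
  RingQuot.mkAlgHom_surjective ℂ (StarClosure R)

theorem mk_eq_of_closure {p q : StarPolynomial σ} (h : StarClosure R p q) : mk R p = mk R q :=
  RingQuot.mkAlgHom_rel ℂ h

theorem mk_eq {p q : StarPolynomial σ} (h : R p q) : mk R p = mk R q :=
  mk_eq_of_closure (.of h)

/-- The adjoint operation on the quotient, as a ring homomorphism to the opposite ring. -/
def starHom : UniversalStarAlgebra R →+* (UniversalStarAlgebra R)ᵐᵒᵖ :=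
  RingQuot.lift (r := StarClosure R)
    ⟨(mk R).toRingHom.op.comp StarPolynomial.starHom, fun _ _ h =>
      congrArg MulOpposite.op (mk_eq_of_closure h.star_mem)⟩

theorem starHom_mk (p : StarPolynomial σ) : starHom (mk R p) = MulOpposite.op (mk R (star p)) := by
  have h : mk R p = RingQuot.mkRingHom (StarClosure R) p :=
    congrArg (fun f => f p) (RingQuot.mkAlgHom_coe ℂ (StarClosure R))
  rw [h]
  exact RingQuot.lift_mkRingHom_apply _ _ p

instance : StarRing (UniversalStarAlgebra R) where
  star x := (starHom x).unop
  star_involutive x := by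
    obtain ⟨p, rfl⟩ := mk_surjective x
    change (starHom (starHom (mk R p)).unop).unop = _
    rw [starHom_mk, MulOpposite.unop_op, starHom_mk, MulOpposite.unop_op, star_star]
  star_mul x y := by rw [map_mul, MulOpposite.unop_mul]
  star_add x y := by rw [map_add, MulOpposite.unop_add]

theorem mk_star (p : StarPolynomial σ) : mk R (star p) = star (mk R p) := by
  change _ = (starHom (mk R p)).unop
  rw [starHom_mk, MulOpposite.unop_op]

instance : StarModule ℂ (UniversalStarAlgebra R) where
  star_smul c x := by
    obtain ⟨p, rfl⟩ := mk_surjective x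
    rw [← map_smul, ← mk_star, star_smul, map_smul, mk_star]

/-- The universal property: a family satisfying the relations defines a unital `*`-homomorphism. -/
def lift {B : Type v} [Ring B] [StarRing B] [Algebra ℂ B] [StarModule ℂ B] (b : σ → B)
    (hb : ∀ p q, R p q → StarPolynomial.eval b p = StarPolynomial.eval b q) :
    UniversalStarAlgebra R →⋆ₐ[ℂ] B :=
  have hb' : ∀ ⦃p q⦄, StarClosure R p q →
      StarPolynomial.eval b p = StarPolynomial.eval b q := by
    intro p q h
    cases h with
    | of h => exact hb _ _ h
    | star h => rw [StarPolynomial.eval_star, StarPolynomial.eval_star, hb _ _ h]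
  have hmk : ∀ p, RingQuot.liftAlgHom ℂ (s := StarClosure R) ⟨StarPolynomial.eval b, hb'⟩ (mk R p) =
      StarPolynomial.eval b p := RingQuot.liftAlgHom_mkAlgHom_apply ℂ (StarPolynomial.eval b) hb'
  { RingQuot.liftAlgHom ℂ (s := StarClosure R) ⟨StarPolynomial.eval b, hb'⟩ with
    map_star' := by
      intro x
      obtain ⟨p, rfl⟩ := mk_surjective x
      refine (congrArg _ (mk_star p).symm).trans ((hmk (star p)).trans ?_)
      exact (StarPolynomial.eval_star b p).trans (congrArg star (hmk p).symm) }

theorem lift_gen {B : Type v} [Ring B] [StarRing B] [Algebra ℂ B] [StarModule ℂ B] (b : σ → B)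
    (hb : ∀ p q, R p q → StarPolynomial.eval b p = StarPolynomial.eval b q) (s : σ) :
    lift b hb (gen R s) = b s := by
  have hb' : ∀ ⦃p q⦄, StarClosure R p q →
      StarPolynomial.eval b p = StarPolynomial.eval b q := by
    intro p q h
    cases h with
    | of h => exact hb _ _ h
    | star h => rw [StarPolynomial.eval_star, StarPolynomial.eval_star, hb _ _ h]
  exact (RingQuot.liftAlgHom_mkAlgHom_apply ℂ (StarPolynomial.eval b) hb' _).trans
    (StarPolynomial.eval_X b s)

theorem adjoin_gen : StarAlgebra.adjoin ℂ (Set.range (gen R)) = ⊤ := by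
  rw [eq_top_iff]
  intro x _
  obtain ⟨p, rfl⟩ := mk_surjective x
  refine FreeAlgebra.induction (R := ℂ) (X := σ ⊕ σ)
    (motive := fun p : StarPolynomial σ => mk R p ∈ StarAlgebra.adjoin ℂ (Set.range (gen R)))
    ?_ ?_ ?_ ?_ p
  · intro c
    change mk R (algebraMap ℂ (StarPolynomial σ) c) ∈ _
    rw [AlgHom.commutes]
    exact algebraMap_mem _ c
  · intro s
    cases s with
    | inl s => exact StarAlgebra.subset_adjoin ℂ _ ⟨s, rfl⟩
    | inr s =>
      change mk R (StarPolynomial.gen (Sum.inr s)) ∈ _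
      rw [← StarPolynomial.star_X, mk_star]
      exact star_mem (StarAlgebra.subset_adjoin ℂ _ ⟨s, rfl⟩)
  · intro a b ha hb
    have h : ∀ p q : StarPolynomial σ, mk R p ∈ StarAlgebra.adjoin ℂ (Set.range (gen R)) →
        mk R q ∈ StarAlgebra.adjoin ℂ (Set.range (gen R)) →
        mk R (p * q) ∈ StarAlgebra.adjoin ℂ (Set.range (gen R)) := by
      intro p q hp hq
      rw [map_mul]; exact mul_mem hp hq
    exact h a b ha hb
  · intro a b ha hb
    have h : ∀ p q : StarPolynomial σ, mk R p ∈ StarAlgebra.adjoin ℂ (Set.range (gen R)) →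
        mk R q ∈ StarAlgebra.adjoin ℂ (Set.range (gen R)) →
        mk R (p + q) ∈ StarAlgebra.adjoin ℂ (Set.range (gen R)) := by
      intro p q hp hq
      rw [map_add]; exact add_mem hp hq
    exact h a b ha hb

end UniversalStarAlgebra

/-! ## Magic unitaries and quantum permutation groups -/

/-- A square matrix over a unital `*`-ring (rows and columns may carry different labels) satisfying
the relations of a magic unitary: the entries are self-adjoint idempotents, each row and each column
sums to `1`, and distinct entries of a row or of a column have product zero. -/
structure IsMagic {V : Type u} {W : Type v} [Fintype V] [Fintype W] {A : Type w} [Ring A]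
    [StarRing A] (U : Matrix V W A) : Prop where
  card_eq : Fintype.card V = Fintype.card W
  star_eq : ∀ i j, star (U i j) = U i j
  mul_self : ∀ i j, U i j * U i j = U i j
  row_sum : ∀ i, ∑ j, U i j = 1
  col_sum : ∀ j, ∑ i, U i j = 1
  row_mul : ∀ i j k, j ≠ k → U i j * U i k = 0
  col_mul : ∀ i j k, i ≠ k → U i j * U k j = 0

/-- The algebraic tensor product of unital `*`-algebras is a `*`-ring. -/
instance tensorStarRing {A : Type u} {B : Type v} [Ring A] [StarRing A] [Algebra ℂ A]
    [StarModule ℂ A] [Ring B] [StarRing B] [Algebra ℂ B] [StarModule ℂ B] :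
    StarRing (A ⊗[ℂ] B) where
  star_add := star_add
  star_mul x y := by
    induction x using TensorProduct.induction_on with
    | zero => simp
    | add x₁ x₂ h₁ h₂ => rw [add_mul, star_add, h₁, h₂, star_add, mul_add]
    | tmul a b =>
      induction y using TensorProduct.induction_on with
      | zero => simp
      | add y₁ y₂ h₁ h₂ => rw [mul_add, star_add, h₁, h₂, star_add, add_mul]
      | tmul c d => simp

/-- A quantum permutation group (of size the cardinality of `V`): a unital `*`-algebra, its algebra
of coefficients, generated by the entries of a magic unitary `p`, with a comultiplication `Δ` that
satisfies `Δ (p i j) = ∑ k, p i k ⊗ p k j`. -/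
structure QuantumPermutationGroup (V : Type u) [Fintype V] where
  Coeff : Type v
  [ring : Ring Coeff]
  [starRing : StarRing Coeff]
  [algebra : Algebra ℂ Coeff]
  [starModule : StarModule ℂ Coeff]
  p : Matrix V V Coeff
  isMagic : IsMagic p
  adjoin_eq_top : StarAlgebra.adjoin ℂ (Set.range fun ij : V × V => p ij.1 ij.2) = ⊤
  comul : Coeff →⋆ₐ[ℂ] Coeff ⊗[ℂ] Coeff
  comul_p : ∀ i j, comul (p i j) = ∑ k, p i k ⊗ₜ[ℂ] p k j

namespace QuantumPermutationGroup

attribute [instance] ring starRing algebra starModule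

/-- Isomorphism of quantum permutation groups, of possibly different sizes: a `*`-isomorphism of the
algebras of coefficients compatible with the comultiplications. -/
def IsIsomorphic {V : Type u} {W : Type v} [Fintype V] [Fintype W]
    (Γ : QuantumPermutationGroup.{u, u} V) (Λ : QuantumPermutationGroup.{v, v} W) : Prop :=
  ∃ f : Γ.Coeff ≃⋆ₐ[ℂ] Λ.Coeff, ∀ a : Γ.Coeff,
    Λ.comul (f a) =
      Algebra.TensorProduct.map (f : Γ.Coeff →⋆ₐ[ℂ] Λ.Coeff).toAlgHom
        (f : Γ.Coeff →⋆ₐ[ℂ] Λ.Coeff).toAlgHom (Γ.comul a)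

/-- The trivial quantum permutation group: its algebra of coefficients is `ℂ`. -/
def one : QuantumPermutationGroup.{0, 0} Unit where
  Coeff := ℂ
  p := 1
  isMagic := by
    constructor <;> simp
  adjoin_eq_top := by
    rw [eq_top_iff]
    intro x _
    exact algebraMap_mem _ x
  comul := { Algebra.ofId ℂ (ℂ ⊗[ℂ] ℂ) with
    map_star' := fun c => algebraMap_star_comm c }
  comul_p i j := by
    change algebraMap ℂ (ℂ ⊗[ℂ] ℂ) _ = _
    simp

/-- A quantum permutation group is trivial if it is isomorphic to the trivial one. -/
def IsTrivial {V : Type u} [Fintype V] (Γ : QuantumPermutationGroup.{u, u} V) : Prop :=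
  Γ.IsIsomorphic one

end QuantumPermutationGroup

/-! ## The quantum automorphism group of a graph -/

/-- The adjacency matrix of a graph, with entries `0` and `1` in a ring. -/
def adj {V : Type u} (G : SimpleGraph V) (A : Type v) [Ring A] : Matrix V V A := by
  classical exact G.adjMatrix A

/-- The matrix of variables `x i j`. -/
def varMatrix (V : Type u) : Matrix V V (StarPolynomial (V × V)) :=
  Matrix.of fun i j => StarPolynomial.X (i, j)

/-- The relations defining the quantum automorphism group of `G`: the matrix of variables is a magic
unitary and commutes with the adjacency matrix of `G`. -/
inductive QuRel {V : Type u} [Fintype V] (G : SimpleGraph V) :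
    StarPolynomial (V × V) → StarPolynomial (V × V) → Prop
  | star_eq (i j : V) : QuRel G (star (varMatrix V i j)) (varMatrix V i j)
  | mul_self (i j : V) : QuRel G (varMatrix V i j * varMatrix V i j) (varMatrix V i j)
  | row_sum (i : V) : QuRel G (∑ j, varMatrix V i j) 1
  | col_sum (j : V) : QuRel G (∑ i, varMatrix V i j) 1
  | row_mul (i j k : V) (h : j ≠ k) : QuRel G (varMatrix V i j * varMatrix V i k) 0
  | col_mul (i j k : V) (h : i ≠ k) : QuRel G (varMatrix V i j * varMatrix V k j) 0
  | adj_comm (i j : V) : QuRel G ((adj G (StarPolynomial (V × V)) * varMatrix V) i j)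
      ((varMatrix V * adj G (StarPolynomial (V × V))) i j)

theorem map_adj {V : Type u} {A : Type v} {B : Type w} [Ring A] [Ring B] (G : SimpleGraph V) (f : A →+* B)
    (i j : V) : f (adj G A i j) = adj G B i j := by
  classical
  simp only [adj, SimpleGraph.adjMatrix_apply]
  split_ifs <;> simp

section Qu

variable {V : Type u} [Fintype V]

/-- The algebra of coefficients of the quantum automorphism group of `G`. -/
abbrev QuCoeff (G : SimpleGraph V) : Type u := UniversalStarAlgebra (QuRel G)

/-- The fundamental representation of the quantum automorphism group of `G`. -/
def fundRep (G : SimpleGraph V) : Matrix V V (QuCoeff G) :=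
  Matrix.of fun i j => UniversalStarAlgebra.gen (QuRel G) (i, j)

theorem mk_varMatrix (G : SimpleGraph V) (i j : V) :
    UniversalStarAlgebra.mk (QuRel G) (varMatrix V i j) = fundRep G i j := rfl

theorem fundRep_isMagic (G : SimpleGraph V) : IsMagic (fundRep G) where
  card_eq := rfl
  star_eq i j := by
    rw [← mk_varMatrix, ← UniversalStarAlgebra.mk_star]
    exact UniversalStarAlgebra.mk_eq (.star_eq i j)
  mul_self i j := by
    rw [← mk_varMatrix, ← map_mul]
    exact UniversalStarAlgebra.mk_eq (.mul_self i j)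
  row_sum i := by
    simp_rw [← mk_varMatrix]
    rw [← map_sum, UniversalStarAlgebra.mk_eq (.row_sum i), map_one]
  col_sum j := by
    simp_rw [← mk_varMatrix]
    rw [← map_sum, UniversalStarAlgebra.mk_eq (.col_sum j), map_one]
  row_mul i j k h := by
    rw [← mk_varMatrix, ← mk_varMatrix, ← map_mul,
      UniversalStarAlgebra.mk_eq (.row_mul i j k h), map_zero]
  col_mul i j k h := by
    rw [← mk_varMatrix, ← mk_varMatrix, ← map_mul,
      UniversalStarAlgebra.mk_eq (.col_mul i j k h), map_zero]

theorem fundRep_adj (G : SimpleGraph V) :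
    adj G (QuCoeff G) * fundRep G = fundRep G * adj G (QuCoeff G) := by
  ext i j
  have h := UniversalStarAlgebra.mk_eq (QuRel.adj_comm (G := G) i j)
  simp only [Matrix.mul_apply, map_sum, map_mul, mk_varMatrix] at h
  have e : ∀ a b, UniversalStarAlgebra.mk (QuRel G) (adj G (StarPolynomial (V × V)) a b) =
      adj G (QuCoeff G) a b := fun a b =>
    map_adj G (UniversalStarAlgebra.mk (QuRel G)).toRingHom a b
  simp only [e] at h
  simpa only [Matrix.mul_apply] using h

/-- A magic unitary adapted to `G` with entries in a unital `*`-algebra satisfies the defining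
relations, so that it defines a unital `*`-homomorphism on the algebra of coefficients. -/
theorem quRel_eval {B : Type v} [Ring B] [StarRing B] [Algebra ℂ B] (G : SimpleGraph V)
    (U : Matrix V V B) (hU : IsMagic U) (hG : adj G B * U = U * adj G B) :
    ∀ p q, QuRel G p q → StarPolynomial.eval (fun ij : V × V => U ij.1 ij.2) p =
      StarPolynomial.eval (fun ij : V × V => U ij.1 ij.2) q := by
  intro p q h
  have e : ∀ i j, StarPolynomial.eval (fun ij : V × V => U ij.1 ij.2) (varMatrix V i j) = U i j :=
    fun i j => StarPolynomial.eval_X _ _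
  cases h with
  | star_eq i j =>
    rw [e, varMatrix, Matrix.of_apply, StarPolynomial.star_X, StarPolynomial.eval_gen]
    exact hU.star_eq i j
  | mul_self i j => rw [map_mul, e, hU.mul_self]
  | row_sum i => simp only [map_sum, e, map_one, hU.row_sum]
  | col_sum j => simp only [map_sum, e, map_one, hU.col_sum]
  | row_mul i j k h => rw [map_mul, e, e, map_zero, hU.row_mul i j k h]
  | col_mul i j k h => rw [map_mul, e, e, map_zero, hU.col_mul i j k h]
  | adj_comm i j =>
    have e' : ∀ a b, StarPolynomial.eval (fun ij : V × V => U ij.1 ij.2)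
        (adj G (StarPolynomial (V × V)) a b) = adj G B a b := fun a b =>
      map_adj G (StarPolynomial.eval (fun ij : V × V => U ij.1 ij.2)).toRingHom a b
    have h := congrFun (congrFun hG i) j
    simpa only [Matrix.mul_apply, map_sum, map_mul, e, e'] using h

/-- The matrix `∑ k, p i k ⊗ p k j` built from the fundamental representation. -/
def comulMatrix (G : SimpleGraph V) : Matrix V V (QuCoeff G ⊗[ℂ] QuCoeff G) :=
  Matrix.of fun i j => ∑ k, fundRep G i k ⊗ₜ[ℂ] fundRep G k j

theorem comulMatrix_mul (G : SimpleGraph V) (i j k l : V) :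
    comulMatrix G i j * comulMatrix G k l =
      ∑ a, ∑ b, (fundRep G i a * fundRep G k b) ⊗ₜ[ℂ] (fundRep G a j * fundRep G b l) := by
  simp only [comulMatrix, Matrix.of_apply, Finset.sum_mul_sum,
    Algebra.TensorProduct.tmul_mul_tmul]

theorem comulMatrix_isMagic (G : SimpleGraph V) : IsMagic (comulMatrix G) where
  card_eq := rfl
  star_eq i j := by
    simp [comulMatrix, (fundRep_isMagic G).star_eq]
  mul_self i j := by
    rw [comulMatrix_mul]
    refine Finset.sum_congr rfl fun a _ => ?_
    rw [Finset.sum_eq_single a]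
    · rw [(fundRep_isMagic G).mul_self, (fundRep_isMagic G).mul_self]
    · intro b _ hb
      rw [(fundRep_isMagic G).row_mul i a b hb.symm, TensorProduct.zero_tmul]
    · simp
  row_sum i := by
    simp only [comulMatrix, Matrix.of_apply]
    rw [Finset.sum_comm]
    simp only [← TensorProduct.tmul_sum, (fundRep_isMagic G).row_sum]
    rw [← TensorProduct.sum_tmul, (fundRep_isMagic G).row_sum, Algebra.TensorProduct.one_def]
  col_sum j := by
    simp only [comulMatrix, Matrix.of_apply]
    rw [Finset.sum_comm]
    simp only [← TensorProduct.sum_tmul, (fundRep_isMagic G).col_sum]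
    rw [← TensorProduct.tmul_sum, (fundRep_isMagic G).col_sum, Algebra.TensorProduct.one_def]
  row_mul i j k h := by
    rw [comulMatrix_mul]
    refine Finset.sum_eq_zero fun a _ => Finset.sum_eq_zero fun b _ => ?_
    by_cases hab : a = b
    · subst hab
      rw [(fundRep_isMagic G).row_mul a j k h, TensorProduct.tmul_zero]
    · rw [(fundRep_isMagic G).row_mul i a b hab, TensorProduct.zero_tmul]
  col_mul i j k h := by
    rw [comulMatrix_mul]
    refine Finset.sum_eq_zero fun a _ => Finset.sum_eq_zero fun b _ => ?_
    by_cases hab : a = b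
    · subst hab
      rw [(fundRep_isMagic G).col_mul i a k h, TensorProduct.zero_tmul]
    · rw [(fundRep_isMagic G).col_mul a j b hab, TensorProduct.tmul_zero]

theorem adj_mul_tmul (G : SimpleGraph V) (a b : V) (x y : QuCoeff G) :
    adj G (QuCoeff G ⊗[ℂ] QuCoeff G) a b * (x ⊗ₜ[ℂ] y) = (adj G (QuCoeff G) a b * x) ⊗ₜ[ℂ] y := by
  classical
  simp only [adj, SimpleGraph.adjMatrix_apply]
  split_ifs <;> simp

theorem tmul_mul_adj (G : SimpleGraph V) (a b : V) (x y : QuCoeff G) :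
    (x ⊗ₜ[ℂ] y) * adj G (QuCoeff G ⊗[ℂ] QuCoeff G) a b = x ⊗ₜ[ℂ] (y * adj G (QuCoeff G) a b) := by
  classical
  simp only [adj, SimpleGraph.adjMatrix_apply]
  split_ifs <;> simp

theorem mul_adj_tmul (G : SimpleGraph V) (a b : V) (x y : QuCoeff G) :
    (x * adj G (QuCoeff G) a b) ⊗ₜ[ℂ] y = x ⊗ₜ[ℂ] (adj G (QuCoeff G) a b * y) := by
  classical
  simp only [adj, SimpleGraph.adjMatrix_apply]
  split_ifs <;> simp

theorem comulMatrix_adj (G : SimpleGraph V) :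
    adj G (QuCoeff G ⊗[ℂ] QuCoeff G) * comulMatrix G =
      comulMatrix G * adj G (QuCoeff G ⊗[ℂ] QuCoeff G) := by
  ext i j
  have h : ∀ a b, ∑ c, adj G (QuCoeff G) a c * fundRep G c b =
      ∑ c, fundRep G a c * adj G (QuCoeff G) c b := fun a b => by
    have := congrFun (congrFun (fundRep_adj G) a) b
    simpa only [Matrix.mul_apply] using this
  simp only [Matrix.mul_apply, comulMatrix, Matrix.of_apply, Finset.mul_sum, Finset.sum_mul,
    adj_mul_tmul, tmul_mul_adj]
  calc ∑ k, ∑ c, (adj G (QuCoeff G) i k * fundRep G k c) ⊗ₜ[ℂ] fundRep G c j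
      = ∑ c, (∑ k, adj G (QuCoeff G) i k * fundRep G k c) ⊗ₜ[ℂ] fundRep G c j := by
        rw [Finset.sum_comm]; simp only [TensorProduct.sum_tmul]
    _ = ∑ c, ∑ k, fundRep G i k ⊗ₜ[ℂ] (adj G (QuCoeff G) k c * fundRep G c j) := by
        simp only [h, TensorProduct.sum_tmul, mul_adj_tmul]
    _ = ∑ k, fundRep G i k ⊗ₜ[ℂ] (∑ c, adj G (QuCoeff G) k c * fundRep G c j) := by
        rw [Finset.sum_comm]; simp only [TensorProduct.tmul_sum]
    _ = ∑ c, ∑ k, fundRep G i k ⊗ₜ[ℂ] (fundRep G k c * adj G (QuCoeff G) c j) := by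
        simp only [h, TensorProduct.tmul_sum]; exact Finset.sum_comm

/-- The quantum automorphism group of a graph. -/
def Qu (G : SimpleGraph V) : QuantumPermutationGroup.{u, u} V where
  Coeff := QuCoeff G
  p := fundRep G
  isMagic := fundRep_isMagic G
  adjoin_eq_top := UniversalStarAlgebra.adjoin_gen
  comul := UniversalStarAlgebra.lift (fun ij : V × V => comulMatrix G ij.1 ij.2)
    (quRel_eval G (comulMatrix G) (comulMatrix_isMagic G) (comulMatrix_adj G))
  comul_p i j := UniversalStarAlgebra.lift_gen (fun ij : V × V => comulMatrix G ij.1 ij.2)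
    (quRel_eval G (comulMatrix G) (comulMatrix_isMagic G) (comulMatrix_adj G)) (i, j)

end Qu

/-! ## Properties of graphs -/

/-- `G` is asymmetric: its automorphism group is trivial. -/
def IsAsymmetric {V : Type u} (G : SimpleGraph V) : Prop :=
  ∀ f : G ≃g G, f = SimpleGraph.Iso.refl

/-- `G` has quantum symmetry: the algebra of coefficients of its quantum automorphism group is not
commutative. -/
def HasQuantumSymmetry {V : Type u} [Fintype V] (G : SimpleGraph V) : Prop :=
  ∃ a b : (Qu G).Coeff, a * b ≠ b * a

/-- The support of an automorphism. -/
def support {V : Type u} {G : SimpleGraph V} (f : G ≃g G) : Set V := {x | f x ≠ x}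

/-- Schmidt's criterion: there are two nontrivial automorphisms with disjoint supports. -/
def SchmidtCriterion {V : Type u} (G : SimpleGraph V) : Prop :=
  ∃ f g : G ≃g G, f ≠ SimpleGraph.Iso.refl ∧ g ≠ SimpleGraph.Iso.refl ∧
    Disjoint (support f) (support g)

/-- `G` is quantum isomorphic to `H`: for some nonzero unital C*-algebra `X` there is a magic unitary
`P` over `X` with `P * Adj G = Adj H * P`. -/
def QuantumIsomorphic {V : Type u} {W : Type v} [Fintype V] [Fintype W] (G : SimpleGraph V)
    (H : SimpleGraph W) : Prop :=
  ∃ (X : Type w) (_ : CStarAlgebra X) (_ : Nontrivial X) (P : Matrix W V X),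
    IsMagic P ∧ P * adj G X = adj H X * P

/-- A class of finite graphs. -/
abbrev GraphClass : Type (u + 1) := ∀ (V : Type u) [Fintype V], SimpleGraph V → Prop

/-- A class of graphs is tractable if it satisfies the axioms on quantum asymmetry, on quantum
isomorphism, and the Schmidt alternative. -/
structure IsTractable (F : GraphClass.{u}) : Prop where
  quantum_asymmetry : ∀ (V : Type u) [Fintype V] (G : SimpleGraph V), F V G →
    (IsAsymmetric G ↔ (Qu G).IsTrivial)
  quantum_isomorphism : ∀ (V W : Type u) [Fintype V] [Fintype W] (G : SimpleGraph V)
    (H : SimpleGraph W), F V G → F W H →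
    (QuantumIsomorphic.{u, u, w} G H ↔ Nonempty (G ≃g H))
  schmidt_alternative : ∀ (V : Type u) [Fintype V] (G : SimpleGraph V), F V G →
    (HasQuantumSymmetry G ↔ SchmidtCriterion G)

/-- The class of forests. -/
def forests : GraphClass.{u} := fun _ _ G => G.IsAcyclic

end QuantumGraph

end

/-! The proof replaces a forest by a single rooted tree that a magic unitary can see. In a forest at
most one neighbour of a vertex has no larger eccentricity (`eq_of_adj_of_ecc_le`); this defines the
direction `inward`. Adding one node for each center and a root above all centers gives `nodeTree`,
from which adjacency can be read off (`adj_iff_nodeTree`). If a magic matrix intertwines the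
adjacency matrices, nonzero products of two entries preserve adjacency, walks and distances, and
nonzero entries preserve eccentricities; hence the matrix respects `inward`
(`IsIntertwiner.mul_inward`) and extends to a magic matrix on the nodes that respects parents
(`isTreeMagic_nodeMatrix`).

For such a matrix, counting entries over pairs of children in two ways shows, from the leaves
upwards, that a nonzero entry joins only nodes with isomorphic branches (`IsTreeMagic.code_eq`).
Applied to the root entry, which is `1`, this gives an isomorphism of quantum isomorphic forests.
Within one tree, nontrivial entries can come only from twins: siblings with isomorphic branches,
which some automorphism exchanges. An asymmetric forest has no twins, so every diagonal entry is
`1`. If Schmidt's criterion fails, no twins lie inside the branch of a twin and any two pairs of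
twins meet, so that all twins are at most three siblings. Every entry is then `0`, `1` or an entry
of a magic matrix of size at most three, and such entries commute (`twin_mul_mul`, `twin_commute`).

Conversely, two automorphisms with disjoint supports can be switched on independently by two
noncommuting projections, which yields a noncommutative image of the algebra of coefficients.
Automorphisms give characters, so a trivial quantum group leaves room for only one automorphism. -/

noncomputable section

namespace QuantumGraph

/-! ## Rooted trees -/

/-- A rooted tree on a set of nodes, given by its parent function, with the root as the only node
that is not of larger rank than its parent. -/
structure ParentTree (N : Type*) where
  parent : N → N
  root : N
  rank : N → ℕ
  parent_root : parent root = root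
  rank_parent_lt : ∀ n, n ≠ root → rank (parent n) < rank n

namespace ParentTree

variable {N : Type*} {M : Type*} (T : ParentTree N) (S : ParentTree M)

theorem rank_parent_le (n : N) : T.rank (T.parent n) ≤ T.rank n := by
  by_cases h : n = T.root
  · rw [h, T.parent_root]
  · exact (T.rank_parent_lt n h).le

theorem rank_iterate_parent_le (k : ℕ) (n : N) : T.rank (T.parent^[k] n) ≤ T.rank n := by
  induction k generalizing n with
  | zero => rfl
  | succ k ih => exact (ih (T.parent n)).trans (T.rank_parent_le n)

theorem eq_root_of_parent_eq {n : N} (h : T.parent n = n) : n = T.root := by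
  by_contra hn
  have := T.rank_parent_lt n hn
  rw [h] at this
  exact this.false

variable {T} in
/-- Induction from the root downwards. -/
theorem induction_parent {P : N → Prop} (root : P T.root)
    (step : ∀ n, n ≠ T.root → P (T.parent n) → P n) (n : N) : P n := by
  induction h : T.rank n using Nat.strong_induction_on generalizing n with
  | _ r ih =>
    by_cases hn : n = T.root
    · rwa [hn]
    · exact step n hn (ih _ (h ▸ T.rank_parent_lt n hn) _ rfl)

section extend

open Classical in
/-- The map of nodes that is built from the root downwards, by means of maps between the sets of
children of pairs of nodes. -/
def extend (r : M) (β : N → M → N → M) (n : N) : M :=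
  if n = T.root then r else β (T.parent n) (extend r β (T.parent n)) n
termination_by T.rank n
decreasing_by exact T.rank_parent_lt n ‹_›

theorem extend_root (r : M) (β : N → M → N → M) : T.extend r β T.root = r := by
  rw [extend, if_pos rfl]

theorem extend_of_ne_root (r : M) (β : N → M → N → M) {n : N} (h : n ≠ T.root) :
    T.extend r β n = β (T.parent n) (T.extend r β (T.parent n)) n := by
  rw [extend, if_neg h]

end extend

/-! ### Codes of branches, and embeddings of trees with equal codes -/

section Fintype

variable [Fintype N] [Fintype M]

open Classical in
/-- The set of children of a node. -/
def children (n : N) : Finset N := Finset.univ.filter fun c => c ≠ T.root ∧ T.parent c = n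

theorem mem_children {n c : N} : c ∈ T.children n ↔ c ≠ T.root ∧ T.parent c = n := by
  simp [children]

theorem rank_lt_of_mem_children {n c : N} (h : c ∈ T.children n) : T.rank n < T.rank c := by
  rw [mem_children] at h
  rw [← h.2]
  exact T.rank_parent_lt c h.1

theorem rank_le_sup (n : N) : T.rank n ≤ Finset.univ.sup T.rank :=
  Finset.le_sup (Finset.mem_univ n)

/-- A code for the isomorphism type of the branch at a node. -/
def code (n : N) : ℕ :=
  Encodable.encode ((T.children n).attach.val.map fun c => code c.1)
termination_by Finset.univ.sup T.rank - T.rank n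
-- Ranks grow towards the leaves, so the gap to their supremum decreases.
decreasing_by
  have h₁ := T.rank_lt_of_mem_children c.2
  have h₂ := T.rank_le_sup c.1
  omega

theorem code_eq (n : N) : T.code n = Encodable.encode ((T.children n).val.map T.code) := by
  rw [code]
  congr 1
  conv_rhs => rw [← Finset.attach_map_val (s := T.children n)]
  rw [Finset.map_val, Multiset.map_map]
  rfl

variable {T} in
/-- Induction from the leaves upwards. -/
theorem induction_children {P : N → Prop} (step : ∀ n, (∀ c ∈ T.children n, P c) → P n) (n : N) :
    P n := by
  induction h : Finset.univ.sup T.rank - T.rank n using Nat.strong_induction_on generalizing n with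
  | _ r ih =>
    refine step n fun c hc => ih _ ?_ c rfl
    have h₁ := T.rank_lt_of_mem_children hc
    have h₂ := T.rank_le_sup c
    omega

-- Multisets agree when all multiplicities do; this is the form of equality that a double count of
-- matrix entries delivers.
open Classical in
theorem code_eq_code_iff {n : N} {m : M} : T.code n = S.code m ↔
    ∀ k, ((T.children n).filter fun c => T.code c = k).card =
      ((S.children m).filter fun c => S.code c = k).card := by
  rw [code_eq, code_eq, Encodable.encode_inj, Multiset.ext]
  refine forall_congr' fun k => ?_
  rw [Multiset.count_map, Multiset.count_map]
  simp only [Finset.card_def, Finset.filter_val, eq_comm]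

/-- Equal codes give equally many children of each code; bijections chosen code by code are glued to
one bijection of the sets of children. -/
theorem exists_childMap {n : N} {m : M} (h : T.code n = S.code m) : ∃ f : N → M,
    (∀ c ∈ T.children n, f c ∈ S.children m ∧ S.code (f c) = T.code c) ∧
      Set.InjOn f (T.children n) := by
  classical
  rw [code_eq_code_iff] at h
  have e : ∀ k, Nonempty ({c : T.children n // T.code c.1 = k} ≃
      {c : S.children m // S.code c.1 = k}) := by
    intro k
    refine Fintype.card_eq.mp ?_
    have hT := h k
    rw [← Fintype.card_coe, ← Fintype.card_coe] at hT
    refine Eq.trans ?_ (hT.trans ?_)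
    · refine Fintype.card_congr ⟨fun c => ⟨c.1.1, by simp [c.2]⟩, fun c => ⟨⟨c.1, ?_⟩, ?_⟩, ?_, ?_⟩
      · exact (Finset.mem_filter.mp c.2).1
      · exact (Finset.mem_filter.mp c.2).2
      · intro c; rfl
      · intro c; rfl
    · refine Fintype.card_congr ⟨fun c => ⟨⟨c.1, ?_⟩, ?_⟩, fun c => ⟨c.1.1, by simp [c.2]⟩, ?_, ?_⟩
      · exact (Finset.mem_filter.mp c.2).1
      · exact (Finset.mem_filter.mp c.2).2
      · intro c; rfl
      · intro c; rfl
  let E : T.children n ≃ S.children m := Equiv.ofFiberEquiv fun k => (e k).some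
  have hE : ∀ c, S.code (E c).1 = T.code c.1 := fun c =>
    Equiv.ofFiberEquiv_map (f := fun c : T.children n => T.code c.1)
      (g := fun c : S.children m => S.code c.1) (fun k => (e k).some) c
  -- Off the children of `n` the value is irrelevant; `S.root` is only a default.
  refine ⟨fun c => if hc : c ∈ T.children n then (E ⟨c, hc⟩).1 else S.root, ?_, ?_⟩
  · intro c hc
    simp only [hc, dif_pos]
    exact ⟨(E ⟨c, hc⟩).2, hE ⟨c, hc⟩⟩
  · intro c hc d hd hcd
    rw [Finset.mem_coe] at hc hd
    simp only [hc, hd, dif_pos] at hcd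
    exact congrArg Subtype.val (E.injective (Subtype.ext hcd))

/-- A family of maps between the sets of children of nodes with equal codes. -/
structure IsChildMap (β : N → M → N → M) : Prop where
  mem : ∀ n m, T.code n = S.code m → ∀ c ∈ T.children n, β n m c ∈ S.children m
  code : ∀ n m, T.code n = S.code m → ∀ c ∈ T.children n, S.code (β n m c) = T.code c
  inj : ∀ n m, T.code n = S.code m → Set.InjOn (β n m) (T.children n)

theorem exists_isChildMap : ∃ β, IsChildMap T S β := by
  classical
  refine ⟨fun n m => if h : T.code n = S.code m then (T.exists_childMap S h).choose
    else fun _ => S.root, ?_, ?_, ?_⟩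
  · intro n m h c hc
    simp only [h, dif_pos]
    exact ((T.exists_childMap S h).choose_spec.1 c hc).1
  · intro n m h c hc
    simp only [h, dif_pos]
    exact ((T.exists_childMap S h).choose_spec.1 c hc).2
  · intro n m h
    simp only [h, dif_pos]
    exact (T.exists_childMap S h).choose_spec.2

/-- An embedding of rooted trees. -/
structure IsEmbedding (φ : N → M) : Prop where
  root : φ T.root = S.root
  parent : ∀ n, φ (T.parent n) = S.parent (φ n)
  injective : Function.Injective φ

variable {T S}

namespace IsChildMap

variable {β : N → M → N → M} (hβ : IsChildMap T S β) (hr : T.code T.root = S.code S.root)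
include hβ hr

theorem code_extend (n : N) : S.code (T.extend S.root β n) = T.code n := by
  induction n using induction_parent (T := T) with
  | root => rw [extend_root, hr]
  | step n hn ih =>
    rw [extend_of_ne_root _ _ _ hn]
    exact hβ.code _ _ ih.symm n (T.mem_children.mpr ⟨hn, rfl⟩)

theorem extend_mem_children {n : N} (hn : n ≠ T.root) :
    T.extend S.root β n ∈ S.children (T.extend S.root β (T.parent n)) := by
  rw [extend_of_ne_root _ _ _ hn]
  exact hβ.mem _ _ (hβ.code_extend hr _).symm n (T.mem_children.mpr ⟨hn, rfl⟩)

/-- For injectivity: only the root reaches the root, since every other node is sent to a child. Two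
other nodes with the same image have parents with the same image, hence the same parent by
induction, and a child map is injective on the children of one node. -/
theorem isEmbedding_extend : IsEmbedding T S (T.extend S.root β) where
  root := T.extend_root _ _
  parent n := by
    by_cases hn : n = T.root
    · rw [hn, T.parent_root, extend_root, S.parent_root]
    · exact (S.mem_children.mp (hβ.extend_mem_children hr hn)).2.symm
  injective n := by
    have root_of : ∀ n, T.extend S.root β n = S.root → n = T.root := fun n h => by
      by_contra hn
      exact (S.mem_children.mp (hβ.extend_mem_children hr hn)).1 h
    induction n using induction_parent (T := T) with
    | root =>
      intro m h
      rw [extend_root] at h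
      exact (root_of m h.symm).symm
    | step n hn ih =>
      intro m h
      have hm : m ≠ T.root := by
        rintro rfl
        rw [extend_root] at h
        exact hn (root_of n h)
      have hp : T.parent n = T.parent m := by
        refine ih ?_
        rw [← (S.mem_children.mp (hβ.extend_mem_children hr hn)).2,
          ← (S.mem_children.mp (hβ.extend_mem_children hr hm)).2, h]
      rw [extend_of_ne_root _ _ _ hn, extend_of_ne_root _ _ _ hm, ← hp] at h
      exact hβ.inj _ _ (hβ.code_extend hr _).symm (T.mem_children.mpr ⟨hn, rfl⟩)
        (T.mem_children.mpr ⟨hm, hp.symm⟩) h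

end IsChildMap

/-- An embedding suffices later on: between forests of the same size it is automatically bijective
on the vertices. -/
theorem exists_isEmbedding (h : T.code T.root = S.code S.root) : ∃ φ, IsEmbedding T S φ :=
  let ⟨_, hβ⟩ := T.exists_isChildMap S
  ⟨_, hβ.isEmbedding_extend h⟩

end Fintype

/-! ### Automorphisms of rooted trees -/

/-- The node `n` lies in the branch at `c`. -/
def Below (c n : N) : Prop := ∃ k, T.parent^[k] n = c

variable {T}

theorem Below.refl (n : N) : T.Below n n := ⟨0, rfl⟩

theorem Below.trans {a b c : N} (h₁ : T.Below a b) (h₂ : T.Below b c) : T.Below a c := by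
  obtain ⟨k, rfl⟩ := h₁
  obtain ⟨l, rfl⟩ := h₂
  exact ⟨k + l, Function.iterate_add_apply _ _ _ _⟩

theorem below_parent (n : N) : T.Below (T.parent n) n := ⟨1, rfl⟩

theorem Below.parent_of_ne {c n : N} (h : T.Below c n) (hn : c ≠ n) : T.Below c (T.parent n) := by
  obtain ⟨k, hk⟩ := h
  cases k with
  | zero => exact absurd hk.symm hn
  | succ k => exact ⟨k, hk⟩

/-- The nodes above `n` form a chain: the longer ascent from `n` passes through the end of the
shorter one. -/
theorem Below.comparable {c d n : N} (hc : T.Below c n) (hd : T.Below d n) :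
    T.Below c d ∨ T.Below d c := by
  obtain ⟨k, rfl⟩ := hc
  obtain ⟨l, rfl⟩ := hd
  rcases le_total k l with h | h
  · right
    obtain ⟨j, rfl⟩ := Nat.exists_eq_add_of_le' h
    exact ⟨j, (Function.iterate_add_apply _ _ _ _).symm⟩
  · left
    obtain ⟨j, rfl⟩ := Nat.exists_eq_add_of_le' h
    exact ⟨j, (Function.iterate_add_apply _ _ _ _).symm⟩

/-- A node strictly above `d` is above the parent of `d`, so its rank is at most that of this
parent; but `c` has larger rank than the common parent. -/
theorem not_below_of_parent_eq {c d : N} (hc : c ≠ T.root) (hp : T.parent c = T.parent d)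
    (hne : c ≠ d) : ¬ T.Below c d := by
  intro h
  obtain ⟨k, hk⟩ := h.parent_of_ne hne
  have h₁ := T.rank_iterate_parent_le k (T.parent d)
  have h₂ := T.rank_parent_lt c hc
  rw [hk, ← hp] at h₁
  omega

variable (T) in
/-- An automorphism of a rooted tree. -/
def IsAut (f : Equiv.Perm N) : Prop := ∀ n, f (T.parent n) = T.parent (f n)

theorem IsAut.mul {f g : Equiv.Perm N} (hf : T.IsAut f) (hg : T.IsAut g) : T.IsAut (f * g) :=
  fun n => by rw [Equiv.Perm.mul_apply, hg n, hf, Equiv.Perm.mul_apply]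

theorem IsAut.inv {f : Equiv.Perm N} (hf : T.IsAut f) : T.IsAut f⁻¹ := fun n => by
  rw [Equiv.Perm.inv_eq_iff_eq, hf]
  exact congrArg T.parent (f.apply_symm_apply n).symm

theorem IsAut.below {f : Equiv.Perm N} (hf : T.IsAut f) {c n : N} (h : T.Below c n) :
    T.Below (f c) (f n) := by
  obtain ⟨k, rfl⟩ := h
  refine ⟨k, ?_⟩
  induction k generalizing n with
  | zero => rfl
  | succ k ih => rw [Function.iterate_succ_apply, ← hf, ih, Function.iterate_succ_apply]

variable (T) in
/-- There are two nontrivial automorphisms of the rooted tree with disjoint supports. -/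
def SchmidtCriterion : Prop :=
  ∃ f g : Equiv.Perm N, T.IsAut f ∧ T.IsAut g ∧ f ≠ 1 ∧ g ≠ 1 ∧ f.Disjoint g

/-! ### Twins and the automorphisms that exchange them -/

section Twins

variable [Fintype N]

variable (T) in
/-- Two distinct children of the same node, with isomorphic branches. -/
structure IsTwin (c d : N) : Prop where
  ne : c ≠ d
  left_ne_root : c ≠ T.root
  right_ne_root : d ≠ T.root
  parent_eq : T.parent c = T.parent d
  code_eq : T.code c = T.code d

theorem IsTwin.symm {c d : N} (h : T.IsTwin c d) : T.IsTwin d c :=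
  ⟨h.ne.symm, h.right_ne_root, h.left_ne_root, h.parent_eq.symm, h.code_eq.symm⟩

theorem IsTwin.not_below {c d n : N} (h : T.IsTwin c d) (hc : T.Below c n) : ¬ T.Below d n := by
  intro hd
  rcases hc.comparable hd with h' | h'
  · exact not_below_of_parent_eq h.left_ne_root h.parent_eq h.ne h'
  · exact not_below_of_parent_eq h.right_ne_root h.parent_eq.symm h.ne.symm h'

/-- Exchanging the branches at two twins. -/
theorem IsTwin.exists_isAut {c d : N} (h : T.IsTwin c d) : ∃ f : Equiv.Perm N, T.IsAut f ∧
    f c = d ∧ ∀ n, f n ≠ n → T.Below c n ∨ T.Below d n := by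
  classical
  obtain ⟨β, hβ⟩ := T.exists_isChildMap T
  -- At a node mapped to itself the children stay in place, except that `c` and `d` are exchanged
  -- below their common parent. At a node mapped elsewhere, inside the two branches, an arbitrary
  -- child map is followed.
  let γ : N → N → N → N := fun n m x =>
    if n = m then if n = T.parent c then Equiv.swap c d x else x else β n m x
  have hsw : ∀ x, T.parent x = T.parent c →
      T.parent (Equiv.swap c d x) = T.parent c ∧ T.code (Equiv.swap c d x) = T.code x ∧
        (x ≠ T.root → Equiv.swap c d x ≠ T.root) := by
    intro x hx
    by_cases h₁ : x = c
    · subst h₁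
      rw [Equiv.swap_apply_left]
      exact ⟨h.parent_eq.symm, h.code_eq.symm, fun _ => h.right_ne_root⟩
    · by_cases h₂ : x = d
      · subst h₂
        rw [Equiv.swap_apply_right]
        exact ⟨rfl, h.code_eq, fun _ => h.left_ne_root⟩
      · rw [Equiv.swap_apply_of_ne_of_ne h₁ h₂]
        exact ⟨hx, rfl, id⟩
  have hγ : IsChildMap T T γ := by
    refine ⟨fun n m hnm x hx => ?_, fun n m hnm x hx => ?_, fun n m hnm x hx y hy hxy => ?_⟩
    · simp only [γ]
      split_ifs with h₁ h₂
      · subst h₁ h₂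
        rw [mem_children] at hx ⊢
        exact ⟨(hsw x hx.2).2.2 hx.1, (hsw x hx.2).1⟩
      · rwa [← h₁]
      · exact hβ.mem n m hnm x hx
    · simp only [γ]
      split_ifs with h₁ h₂
      · subst h₂
        exact (hsw x (T.mem_children.mp hx).2).2.1
      · rfl
      · exact hβ.code n m hnm x hx
    · simp only [γ] at hxy
      split_ifs at hxy with h₁ h₂
      · exact (Equiv.swap c d).injective hxy
      · exact hxy
      · exact hβ.inj n m hnm hx hy hxy
  have emb := hγ.isEmbedding_extend rfl
  -- A node outside both branches has its parent outside both, so along its ancestors only the case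
  -- `n = m` of `γ` is met.
  have hfix : ∀ n, ¬ T.Below c n → ¬ T.Below d n → T.extend T.root γ n = n := by
    intro n
    induction n using induction_parent (T := T) with
    | root => intro _ _; rw [extend_root]
    | step n hn ih =>
      intro hc hd
      rw [extend_of_ne_root _ _ _ hn, ih (fun h' => hc (h'.trans (below_parent n)))
        (fun h' => hd (h'.trans (below_parent n)))]
      simp only [γ, if_true]
      split_ifs
      · exact Equiv.swap_apply_of_ne_of_ne (fun h' => hc (h' ▸ Below.refl n))
          (fun h' => hd (h' ▸ Below.refl n))
      · rfl
  have hpar : T.extend T.root γ (T.parent c) = T.parent c := by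
    refine hfix _ (fun h' => ?_) (fun h' => ?_)
    · obtain ⟨k, hk⟩ := h'
      have h₁ := T.rank_iterate_parent_le k (T.parent c)
      have h₂ := T.rank_parent_lt c h.left_ne_root
      rw [hk] at h₁
      omega
    · obtain ⟨k, hk⟩ := h'
      have h₁ := T.rank_iterate_parent_le k (T.parent c)
      have h₂ := T.rank_parent_lt d h.right_ne_root
      rw [hk, h.parent_eq] at h₁
      omega
  refine ⟨Equiv.ofBijective _ (Finite.injective_iff_bijective.mp emb.injective), emb.parent, ?_, ?_⟩
  · rw [Equiv.ofBijective_apply, extend_of_ne_root _ _ _ h.left_ne_root, hpar]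
    simp [γ]
  · intro n hn
    by_contra hcon
    rw [not_or] at hcon
    exact hn (hfix n hcon.1 hcon.2)

theorem ne_one_of_apply_eq {f : Equiv.Perm N} {c d : N} (h : T.IsTwin c d) (hf : f c = d) :
    f ≠ 1 := by
  rintro rfl
  exact h.ne hf

/-- Twins in the branch at a twin yield Schmidt's criterion. -/
theorem IsTwin.schmidtCriterion_of_below {c c' d d' : N} (hc : T.IsTwin c c') (hd : T.IsTwin d d')
    (h : T.Below c (T.parent d)) : T.SchmidtCriterion := by
  obtain ⟨f, hf, hfc, -⟩ := hc.exists_isAut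
  obtain ⟨g, hg, hgd, hgs⟩ := hd.exists_isAut
  have supp : ∀ n, g n ≠ n → T.Below c n := by
    intro n hn
    rcases hgs n hn with h' | h'
    · exact h.trans ((below_parent d).trans h')
    · rw [hd.parent_eq] at h
      exact h.trans ((below_parent d').trans h')
  -- `g` moves only nodes of the branch at `c`. As `f` carries `c` to `c'`, the conjugate moves only
  -- nodes of the branch at `c'`, which is disjoint from it.
  refine ⟨g, f * g * f⁻¹, hg, (hf.mul hg).mul hf.inv, ne_one_of_apply_eq hd hgd, ?_, ?_⟩
  · rw [Ne, conj_eq_one_iff]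
    exact ne_one_of_apply_eq hd hgd
  · intro n
    by_contra hcon
    rw [not_or] at hcon
    have h₁ := supp n hcon.1
    have h₂ : g (f⁻¹ n) ≠ f⁻¹ n := by
      intro h'
      refine hcon.2 ?_
      rw [Equiv.Perm.mul_apply, Equiv.Perm.mul_apply, h']
      exact f.apply_symm_apply n
    have h₃ := hf.below (supp _ h₂)
    rw [hfc, show f (f⁻¹ n) = n from f.apply_symm_apply n] at h₃
    exact hc.not_below h₁ h₃

/-- Two disjoint pairs of twins yield Schmidt's criterion. -/
theorem IsTwin.schmidtCriterion {c c' d d' : N} (hc : T.IsTwin c c') (hd : T.IsTwin d d')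
    (h₁ : c ≠ d) (h₂ : c ≠ d') (h₃ : c' ≠ d) (h₄ : c' ≠ d') : T.SchmidtCriterion := by
  -- If two branches at twins meet, one of them contains the other pair of twins and the nested case
  -- applies. Otherwise the two exchanges have disjoint supports.
  have key : ∀ {a a' b b' : N}, T.IsTwin a a' → T.IsTwin b b' → a ≠ b → ∀ n,
      T.Below a n → T.Below b n → T.SchmidtCriterion := by
    intro a a' b b' ha hb hab n han hbn
    rcases han.comparable hbn with h | h
    · exact ha.schmidtCriterion_of_below hb (h.parent_of_ne hab)
    · exact hb.schmidtCriterion_of_below ha (h.parent_of_ne hab.symm)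
  obtain ⟨f, hf, hfc, hfs⟩ := hc.exists_isAut
  obtain ⟨g, hg, hgd, hgs⟩ := hd.exists_isAut
  by_contra hcon
  refine hcon ⟨f, g, hf, hg, ne_one_of_apply_eq hc hfc, ne_one_of_apply_eq hd hgd, fun n => ?_⟩
  by_contra hn
  rw [not_or] at hn
  rcases hfs n hn.1 with h | h <;> rcases hgs n hn.2 with h' | h'
  · exact hcon (key hc hd h₁ n h h')
  · exact hcon (key hc hd.symm h₂ n h h')
  · exact hcon (key hc.symm hd h₃ n h h')
  · exact hcon (key hc.symm hd.symm h₄ n h h')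

end Twins

end ParentTree

/-! ## Magic matrices -/

/-- The relations of a magic unitary that do not involve adjoints. -/
structure IsMagicMatrix {V W A : Type*} [Fintype V] [Fintype W] [Ring A] (U : Matrix W V A) :
    Prop where
  mul_self : ∀ i j, U i j * U i j = U i j
  row_sum : ∀ i, ∑ j, U i j = 1
  col_sum : ∀ j, ∑ i, U i j = 1
  row_mul : ∀ i j k, j ≠ k → U i j * U i k = 0
  col_mul : ∀ i j k, i ≠ k → U i j * U k j = 0

theorem IsMagic.isMagicMatrix {V W A : Type*} [Fintype V] [Fintype W] [Ring A] [StarRing A]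
    {U : Matrix W V A} (h : IsMagic U) : IsMagicMatrix U :=
  ⟨h.mul_self, h.row_sum, h.col_sum, h.row_mul, h.col_mul⟩

theorem IsMagicMatrix.transpose {V W A : Type*} [Fintype V] [Fintype W] [Ring A]
    {U : Matrix W V A} (h : IsMagicMatrix U) : IsMagicMatrix U.transpose :=
  ⟨fun i j => h.mul_self j i, h.col_sum, h.row_sum, fun i j k => h.col_mul j i k,
    fun i j k => h.row_mul j i k⟩

/-- Passing to the opposite ring reverses products, so a one-sided identity for all magic matrices
yields its mirror image without any adjoints. -/
theorem IsMagicMatrix.op {V W A : Type*} [Fintype V] [Fintype W] [Ring A] {U : Matrix W V A}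
    (h : IsMagicMatrix U) : IsMagicMatrix (Matrix.of fun n m => MulOpposite.op (U n m)) where
  mul_self n m := congrArg MulOpposite.op (h.mul_self n m)
  row_sum n := (Finset.op_sum _ _).symm.trans (congrArg MulOpposite.op (h.row_sum n))
  col_sum m := (Finset.op_sum _ _).symm.trans (congrArg MulOpposite.op (h.col_sum m))
  row_mul n m m' hm := congrArg MulOpposite.op (h.row_mul n m' m hm.symm)
  col_mul n m n' hn := congrArg MulOpposite.op (h.col_mul n' m n hn.symm)

/-- The complex scalars make it possible to compare cardinalities through multiples of a nonzero
entry. -/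
theorem smul_right_eq_of_ne_zero {A : Type*} [Ring A] [Algebra ℂ A] {x : A} (hx : x ≠ 0) {a b : ℕ}
    (h : a • x = b • x) : a = b := by
  rw [← Nat.cast_smul_eq_nsmul ℂ, ← Nat.cast_smul_eq_nsmul ℂ] at h
  exact_mod_cast smul_left_injective ℂ hx h

/-- A magic matrix that is compatible with the parent functions of two rooted trees. -/
structure IsTreeMagic {N M A : Type*} [Fintype N] [Fintype M] [Ring A] (T : ParentTree N)
    (S : ParentTree M) (U : Matrix N M A) : Prop extends IsMagicMatrix U where
  root : U T.root S.root = 1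
  mul_parent : ∀ n m, U n m * U (T.parent n) (S.parent m) = U n m

namespace IsTreeMagic

open ParentTree

variable {N M A : Type*} [Fintype N] [Fintype M] [Ring A] {T : ParentTree N} {S : ParentTree M}
  {U : Matrix N M A} (h : IsTreeMagic T S U)
include h

theorem transpose : IsTreeMagic S T U.transpose where
  toIsMagicMatrix := h.toIsMagicMatrix.transpose
  root := h.root
  mul_parent n m := h.mul_parent m n

theorem root_left {m : M} (hm : m ≠ S.root) : U T.root m = 0 := by
  have := h.row_mul T.root m S.root hm
  rwa [h.root, mul_one] at this

theorem root_right {n : N} (hn : n ≠ T.root) : U n S.root = 0 := h.transpose.root_left hn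

/-- Multiply the sum of row `n` on the right by `U (T.parent n) m`. By `mul_parent` and
orthogonality in the row of the parent, the term of `d` survives unchanged if `d` is a child of `m`,
and vanishes otherwise. -/
theorem sum_children_right {n : N} (hn : n ≠ T.root) (m : M) :
    ∑ d ∈ S.children m, U n d = U (T.parent n) m := by
  classical
  have h₁ : ∀ d ∈ Finset.univ, U n d * U (T.parent n) m =
      if d ∈ S.children m then U n d else 0 := by
    intro d _
    by_cases hd : d = S.root
    · have : d ∉ S.children m := fun h' => (S.mem_children.mp h').1 hd
      rw [if_neg this, hd, h.root_right hn, zero_mul]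
    · simp only [mem_children, hd, ne_eq, not_false_eq_true, true_and]
      split_ifs with h'
      · rw [← h', h.mul_parent]
      · rw [← h.mul_parent, mul_assoc, h.row_mul _ _ _ h', mul_zero]
  have h₂ := Finset.sum_congr rfl h₁
  rw [← Finset.sum_mul, h.row_sum, one_mul] at h₂
  rw [h₂, ← Finset.sum_filter]
  exact Finset.sum_congr (by ext; simp) fun _ _ => rfl

theorem sum_children_left (n : N) {m : M} (hm : m ≠ S.root) :
    ∑ c ∈ T.children n, U c m = U n (S.parent m) := h.transpose.sum_children_right hm n

/-- This mirrors `mul_parent`: the entry at the parents is a sum of entries of row `n` over siblings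
of `m`, and orthogonality keeps only `U n m`. It is what makes the matrix over the opposite ring
compatible with parents. -/
theorem parent_mul {n : N} {m : M} (hn : n ≠ T.root) :
    U (T.parent n) (S.parent m) * U n m = U n m := by
  by_cases hm : m = S.root
  · rw [hm, h.root_right hn, mul_zero]
  · classical
    rw [← h.sum_children_right hn, Finset.sum_mul, Finset.sum_eq_single m, h.mul_self]
    · exact fun d _ hd => h.row_mul n d m hd
    · exact fun h' => absurd (S.mem_children.mpr ⟨hm, rfl⟩) h'

theorem op : IsTreeMagic T S (Matrix.of fun n m => MulOpposite.op (U n m)) where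
  toIsMagicMatrix := h.toIsMagicMatrix.op
  root := congrArg MulOpposite.op h.root
  mul_parent n m := by
    refine congrArg MulOpposite.op (?_ : U (T.parent n) (S.parent m) * U n m = U n m)
    by_cases hn : n = T.root
    · by_cases hm : m = S.root
      · rw [hn, hm, T.parent_root, S.parent_root, h.mul_self]
      · rw [hn, h.root_left hm, mul_zero]
    · exact h.parent_mul hn

theorem parent_ne_zero {n : N} {m : M} (hU : U n m ≠ 0) : U (T.parent n) (S.parent m) ≠ 0 := by
  intro h'
  rw [← h.mul_parent, h', mul_zero] at hU
  exact hU rfl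

/-- The nonzero entries of a magic matrix respect the isomorphism types of the branches. -/
theorem code_eq [Algebra ℂ A] {n : N} {m : M} (hU : U n m ≠ 0) : T.code n = S.code m := by
  classical
  induction n using induction_children (T := T) generalizing m with
  | step n ih =>
    rw [code_eq_code_iff]
    intro k
    refine smul_right_eq_of_ne_zero hU ?_
    -- Sum `U c d` over the children of `n` and of `m` of code `k`. By induction entries between
    -- different codes vanish, so each partial row sum equals `U n m`, and so does each partial
    -- column sum; the total is `U n m` times either number of children.
    have h₁ : ∑ c ∈ (T.children n).filter (fun c => T.code c = k),
        ∑ d ∈ (S.children m).filter (fun d => S.code d = k), U c d =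
        ∑ c ∈ (T.children n).filter (fun c => T.code c = k), U n m := by
      refine Finset.sum_congr rfl fun c hc => ?_
      rw [Finset.mem_filter] at hc
      have hcn := T.mem_children.mp hc.1
      have := h.sum_children_right hcn.1 m
      rw [hcn.2] at this
      rw [← this]
      refine Finset.sum_filter_of_ne fun d hd hne => ?_
      rw [← ih c hc.1 hne, hc.2]
    have h₂ : ∑ d ∈ (S.children m).filter (fun d => S.code d = k),
        ∑ c ∈ (T.children n).filter (fun c => T.code c = k), U c d =
        ∑ d ∈ (S.children m).filter (fun d => S.code d = k), U n m := by
      refine Finset.sum_congr rfl fun d hd => ?_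
      rw [Finset.mem_filter] at hd
      have hdm := S.mem_children.mp hd.1
      have := h.sum_children_left n hdm.1
      rw [hdm.2] at this
      rw [← this]
      refine Finset.sum_filter_of_ne fun c hc hne => ?_
      rw [ih c hc hne, hd.2]
    have h₃ := h₁.symm.trans (Finset.sum_comm.trans h₂)
    rwa [Finset.sum_const, Finset.sum_const] at h₃

end IsTreeMagic

/-- In the absence of Schmidt's criterion, all twins are twins of each other. -/
theorem ParentTree.IsTwin.eq_or_isTwin {N : Type*} [Fintype N] {T : ParentTree N}
    (hS : ¬ T.SchmidtCriterion) {a b c e : N} (hab : T.IsTwin a b) (hce : T.IsTwin c e) :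
    a = c ∨ T.IsTwin a c := by
  by_cases h₁ : a = c
  · exact Or.inl h₁
  refine Or.inr ?_
  by_cases h₂ : a = e
  · rw [h₂]; exact hce.symm
  by_cases h₃ : b = c
  · rw [← h₃]; exact hab
  by_cases h₄ : b = e
  · refine ⟨h₁, hab.left_ne_root, hce.left_ne_root, ?_, ?_⟩
    · rw [hab.parent_eq, hce.parent_eq, h₄]
    · rw [hab.code_eq, hce.code_eq, h₄]
  exact absurd (hab.schmidtCriterion hce h₁ h₂ h₃ h₄) hS

/-! ### Magic matrices on one rooted tree -/

namespace IsTreeMagic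

open ParentTree

variable {N A : Type*} [Fintype N] [Ring A] {T : ParentTree N} {U : Matrix N N A}
  (h : IsTreeMagic T T U)
include h

theorem eq_zero_of_diag_eq_one {n m : N} (hn : U n n = 1) (hm : n ≠ m) : U n m = 0 := by
  have := h.row_mul n n m hm
  rwa [hn, one_mul] at this

variable [Algebra ℂ A]

/-- A nonzero entry at a child of a node with diagonal entry `1` lies on the diagonal or at a
twin. -/
theorem eq_or_isTwin {n m : N} (hn : n ≠ T.root) (hp : U (T.parent n) (T.parent n) = 1)
    (hU : U n m ≠ 0) : n = m ∨ T.IsTwin n m := by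
  rw [or_iff_not_imp_left]
  intro hne
  have hpm : T.parent n = T.parent m := by
    by_contra h'
    exact h.parent_ne_zero hU (h.eq_zero_of_diag_eq_one hp h')
  refine ⟨hne, hn, ?_, hpm, h.code_eq hU⟩
  rintro rfl
  exact hU (h.root_right hn)

/-- Expand the entry of the parent as a sum over its children: a nonzero term off the diagonal would
exhibit a twin of `n`. -/
theorem diag_eq_parent {n : N} (hn : n ≠ T.root) (ht : ∀ m, ¬ T.IsTwin n m) :
    U n n = U (T.parent n) (T.parent n) := by
  classical
  rw [← h.sum_children_right hn]
  refine (Finset.sum_eq_single n ?_ ?_).symm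
  · intro m hm hmn
    by_contra hU
    rw [mem_children] at hm
    exact ht m ⟨hmn.symm, hn, hm.1, hm.2.symm, h.code_eq hU⟩
  · intro h'
    exact absurd (T.mem_children.mpr ⟨hn, rfl⟩) h'

/-- The entry `1` at the root is passed down as long as no twin is met. -/
theorem diag_eq_one {n : N} (ht : ∀ c, T.Below c n → ∀ d, ¬ T.IsTwin c d) : U n n = 1 := by
  induction n using induction_parent (T := T) with
  | root => exact h.root
  | step n hn ih =>
    rw [h.diag_eq_parent hn (ht n (Below.refl n)),
      ih fun c hc => ht c (hc.trans (below_parent n))]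

variable (hS : ¬ T.SchmidtCriterion)
include hS

/-- A twin above the parent of a twin would give Schmidt's criterion by nesting, so the path from
the root to this parent is free of twins. -/
theorem parent_diag_eq_one {c d : N} (ht : T.IsTwin c d) :
    U (T.parent c) (T.parent c) = 1 :=
  h.diag_eq_one fun _ ha _ hab => hS (hab.schmidtCriterion_of_below ht ha)

/-- In the absence of Schmidt's criterion, every entry of a magic matrix is `0`, `1`, or an entry
in a row of a twin. -/
theorem eq_zero_or_eq_one_or (n m : N) : U n m = 0 ∨ U n m = 1 ∨
    ∃ c d e, T.IsTwin c e ∧ (c = d ∨ T.IsTwin c d) ∧ U n m = U c d := by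
  classical
  induction n using induction_parent (T := T) generalizing m with
  | root =>
    by_cases hm : m = T.root
    · subst hm; exact Or.inr (Or.inl h.root)
    · exact Or.inl (h.root_left hm)
  | step n hn ih =>
    by_cases hU : U n m = 0
    · exact Or.inl hU
    by_cases ht : ∃ e, T.IsTwin n e
    · obtain ⟨e, he⟩ := ht
      exact Or.inr (Or.inr ⟨n, m, e, he,
        h.eq_or_isTwin hn (h.parent_diag_eq_one hS he) hU, rfl⟩)
    · have hm : m ≠ T.root := by
        rintro rfl
        exact hU (h.root_right hn)
      -- Another sibling with a nonzero entry in column `m` would share the code of `m`, hence of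
      -- `n`, and be a twin; so the sum over the siblings of `n` reduces to one term.
      have : U n m = U (T.parent n) (T.parent m) := by
        rw [← h.sum_children_left _ hm]
        refine (Finset.sum_eq_single (f := fun c => U c m) n ?_ ?_).symm
        · intro c hc hcn
          by_contra hc'
          rw [mem_children] at hc
          exact ht ⟨c, hcn.symm, hn, hc.1, hc.2.symm,
            (h.code_eq hU).trans (h.code_eq hc').symm⟩
        · intro h'
          exact absurd (T.mem_children.mpr ⟨hn, rfl⟩) h'
      rw [this]
      exact ih _

/-- The entries at twins commute: there are at most three of them. -/
theorem twin_mul_mul {i k j l : N} (hi : T.IsTwin i k) (hj : i = j ∨ T.IsTwin i j)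
    (hl : i = l ∨ T.IsTwin i l) (hjl : j ≠ l) : U i j * U k l * U i j = U i j * U k l := by
  classical
  have hp := h.parent_diag_eq_one hS hi
  have twin : ∀ b, (i = b ∨ T.IsTwin i b) → ∀ b', (i = b' ∨ T.IsTwin i b') → b ≠ b' →
      T.IsTwin b b' := by
    rintro b (rfl | hb) b' (rfl | hb') hne
    · exact absurd rfl hne
    · exact hb'
    · exact hb.symm
    · exact ⟨hne, hb.right_ne_root, hb'.right_ne_root, hb.parent_eq.symm.trans hb'.parent_eq,
        hb.code_eq.symm.trans hb'.code_eq⟩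
  -- This is the argument for magic matrices of size three: `U i j * U k l` is multiplied by the sum
  -- of row `i`, and only the term of `j` survives.
  have hz : ∀ b, b ≠ j → U i j * U k l * U i b = 0 := by
    intro b hb
    by_cases hbl : b = l
    · rw [mul_assoc, hbl, h.col_mul k l i hi.ne.symm, mul_zero]
    by_cases hib : U i b = 0
    · rw [hib, mul_zero]
    have hb' := h.eq_or_isTwin hi.left_ne_root hp hib
    -- Row `k` lives on the twins `l`, `j`, `b` alone: a fourth twin `x` would give the disjoint
    -- pairs `j, l` and `b, x`.
    have e : U k l = 1 - U k j - U k b := by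
      rw [sub_sub, eq_sub_iff_add_eq, ← h.row_sum k,
        ← Finset.sum_subset (Finset.subset_univ {l, j, b})]
      · rw [Finset.sum_insert, Finset.sum_insert, Finset.sum_singleton]
        · simpa using hb.symm
        · simpa using ⟨hjl.symm, fun h' => hbl h'.symm⟩
      · intro x _ hx
        simp only [Finset.mem_insert, Finset.mem_singleton, not_or] at hx
        by_contra hkx
        have hx' : i = x ∨ T.IsTwin i x := by
          rcases h.eq_or_isTwin hi.right_ne_root (hi.parent_eq ▸ hp) hkx with h' | h'
          · exact Or.inr (h' ▸ hi)
          · by_cases hix : i = x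
            · exact Or.inl hix
            · exact Or.inr ⟨hix, hi.left_ne_root, h'.right_ne_root,
                hi.parent_eq.trans h'.parent_eq, hi.code_eq.trans h'.code_eq⟩
        exact hS ((twin j hj l hl hjl).schmidtCriterion (twin b hb' x hx' (Ne.symm hx.2.2))
          hb.symm (Ne.symm hx.2.1) (Ne.symm hbl) (Ne.symm hx.1))
    rw [e, mul_sub, mul_sub, mul_one, h.col_mul i j k hi.ne, sub_zero, sub_mul, mul_assoc,
      h.col_mul k b i hi.ne.symm, mul_zero, sub_zero, h.row_mul i j b hb.symm]
  have hs : U i j * U k l = ∑ b, U i j * U k l * U i b := by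
    rw [← Finset.mul_sum, h.row_sum, mul_one]
  rw [Finset.sum_eq_single j (fun b _ hb => hz b hb) (by simp)] at hs
  exact hs.symm

/-- Over the opposite ring, `twin_mul_mul` equates `U i j * U k l * U i j` with `U k l * U i j`; the
original equates it with `U i j * U k l`. -/
theorem twin_commute {i k j l : N} (hi : T.IsTwin i k) (hj : i = j ∨ T.IsTwin i j)
    (hl : i = l ∨ T.IsTwin i l) : Commute (U i j) (U k l) := by
  by_cases hjl : j = l
  · rw [Commute, SemiconjBy, hjl, h.col_mul _ _ _ hi.ne, h.col_mul _ _ _ hi.ne.symm]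
  · have h₁ := h.twin_mul_mul hS hi hj hl hjl
    have h₂ := congrArg MulOpposite.unop (h.op.twin_mul_mul hS hi hj hl hjl)
    rw [Commute, SemiconjBy, ← h₁, mul_assoc]
    exact h₂

/-- In the absence of Schmidt's criterion, the entries of a magic matrix commute. -/
theorem commute (n m n' m' : N) : Commute (U n m) (U n' m') := by
  rcases h.eq_zero_or_eq_one_or hS n m with h₁ | h₁ | ⟨c, d, e, hce, hcd, h₁⟩
  · rw [h₁]; exact Commute.zero_left _
  · rw [h₁]; exact Commute.one_left _
  rcases h.eq_zero_or_eq_one_or hS n' m' with h₂ | h₂ | ⟨c', d', e', hce', hcd', h₂⟩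
  · rw [h₂]; exact Commute.zero_right _
  · rw [h₂]; exact Commute.one_right _
  rw [h₁, h₂]
  -- The two rows coincide, and orthogonality applies, or they belong to twins of each other.
  rcases hce.eq_or_isTwin hS hce' with rfl | hcc'
  · by_cases hd : d = d'
    · rw [hd]
    · rw [Commute, SemiconjBy, h.row_mul _ _ _ hd, h.row_mul _ _ _ (Ne.symm hd)]
  · refine h.twin_commute hS hcc' hcd ?_
    rcases hcd' with rfl | hcd'
    · exact Or.inr hcc'
    · by_cases hcd'' : c = d'
      · exact Or.inl hcd''
      · exact Or.inr ⟨hcd'', hcc'.left_ne_root, hcd'.right_ne_root,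
          hcc'.parent_eq.trans hcd'.parent_eq, hcc'.code_eq.trans hcd'.code_eq⟩

end IsTreeMagic

/-! ## The rooted tree of a forest -/

/-! ### Eccentricity and the direction of the center -/

section Eccentricity

variable {V : Type*} [Fintype V] (G : SimpleGraph V)

/-- The largest distance from a vertex to a vertex of its connected component. -/
def ecc (v : V) : ℕ := Finset.univ.sup (G.dist v)

theorem dist_le_ecc (v w : V) : G.dist v w ≤ ecc G v := Finset.le_sup (Finset.mem_univ w)

theorem exists_dist_eq_ecc (v : V) : ∃ w, G.dist v w = ecc G v := by
  obtain ⟨w, -, hw⟩ := Finset.exists_mem_eq_sup Finset.univ ⟨v, Finset.mem_univ v⟩ (G.dist v)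
  exact ⟨w, hw.symm⟩

variable {G}

/-- In a forest, at most one neighbour of a vertex has at most its eccentricity. -/
theorem eq_of_adj_of_ecc_le (hG : G.IsAcyclic) {v w w' : V} (h : G.Adj v w) (h' : G.Adj v w')
    (hw : ecc G w ≤ ecc G v) (hw' : ecc G w' ≤ ecc G v) : w = w' := by
  classical
  obtain ⟨x, hx⟩ := exists_dist_eq_ecc G v
  -- Distances between components are `0`, while the neighbour `w` makes the eccentricity of `v`
  -- positive; so `x` lies in the component of `v`.
  have hr : G.Reachable v x := by
    refine SimpleGraph.Reachable.of_dist_ne_zero ?_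
    have := dist_le_ecc G v w
    rw [SimpleGraph.dist_eq_one_iff_adj.mpr h] at this
    omega
  -- A shortest path from `y` to the farthest vertex `x` is no longer than `dist v x`, so it cannot
  -- first return to `v`. Prepending `v` gives a path from `v` to `x`; such a path is unique in a
  -- forest, and so is its second vertex.
  have key : ∀ {y : V} (hy : G.Adj v y), ecc G y ≤ ecc G v →
      ∃ p : G.Walk y x, (p.cons hy).IsPath := by
    intro y hy hle
    obtain ⟨p, hp, hl⟩ := (hy.symm.reachable.trans hr).exists_path_of_dist
    refine ⟨p, hp.cons fun hv => ?_⟩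
    have h₁ := SimpleGraph.dist_le (p.dropUntil v hv)
    have h₂ := congrArg SimpleGraph.Walk.length (p.take_spec hv)
    rw [SimpleGraph.Walk.length_append] at h₂
    have h₃ : (p.takeUntil v hv).length ≠ 0 := fun h₀ =>
      hy.ne (SimpleGraph.Walk.eq_of_length_eq_zero h₀).symm
    have h₄ := dist_le_ecc G y x
    omega
  obtain ⟨p, hp⟩ := key h hw
  obtain ⟨p', hp'⟩ := key h' hw'
  have e := (hG.subsingleton_path v x).elim ⟨_, hp⟩ ⟨_, hp'⟩
  have e' := congrArg SimpleGraph.Walk.snd (congrArg Subtype.val e)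
  simpa using e'

variable (G) in
open Classical in
/-- The neighbour of a vertex in the direction of the center of its component, or the vertex itself
if there is none. -/
def inward (v : V) : V :=
  if h : ∃ w, G.Adj v w ∧ ecc G w ≤ ecc G v then h.choose else v

theorem inward_eq (hG : G.IsAcyclic) {v w : V} (h : G.Adj v w) (hw : ecc G w ≤ ecc G v) :
    inward G v = w := by
  have h' : ∃ w, G.Adj v w ∧ ecc G w ≤ ecc G v := ⟨w, h, hw⟩
  rw [inward, dif_pos h']
  exact eq_of_adj_of_ecc_le hG h'.choose_spec.1 h h'.choose_spec.2 hw

theorem adj_inward_or_eq (v : V) : G.Adj v (inward G v) ∨ inward G v = v := by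
  by_cases h : ∃ w, G.Adj v w ∧ ecc G w ≤ ecc G v
  · rw [inward, dif_pos h]
    exact Or.inl h.choose_spec.1
  · rw [inward, dif_neg h]
    exact Or.inr rfl

theorem ecc_inward_le (v : V) : ecc G (inward G v) ≤ ecc G v := by
  by_cases h : ∃ w, G.Adj v w ∧ ecc G w ≤ ecc G v
  · rw [inward, dif_pos h]
    exact h.choose_spec.2
  · rw [inward, dif_neg h]

variable (G) in
/-- A vertex of smallest eccentricity in its component. -/
def IsCentral (v : V) : Prop := ecc G (inward G v) = ecc G v

/-- Two adjacent vertices of equal eccentricity are each the inward neighbour of the other. -/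
theorem IsCentral.inward_inward (hG : G.IsAcyclic) {v : V} (h : IsCentral G v) :
    inward G (inward G v) = v := by
  rcases adj_inward_or_eq (G := G) v with h' | h'
  · exact inward_eq hG h'.symm h.symm.le
  · rw [h', h']

theorem IsCentral.inward (hG : G.IsAcyclic) {v : V} (h : IsCentral G v) :
    IsCentral G (inward G v) := by
  rw [IsCentral, h.inward_inward hG]
  exact h.symm

end Eccentricity

/-! ### The tree of centers and vertices -/

section NodeTree

variable {V : Type*} [Fintype V] (G : SimpleGraph V)

open Classical in
/-- The centers of the components of a forest: sets of one vertex or of two adjacent vertices. -/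
def Center : Type _ := {s : Finset V // ∃ v, IsCentral G v ∧ s = {v, inward G v}}

instance : Fintype (Center G) :=
  have : Finite (Center G) := inferInstanceAs (Finite (Subtype _))
  Fintype.ofFinite _

/-- The nodes of the rooted tree of a forest: the root, the centers of the components, and the
vertices. -/
abbrev Node : Type _ := Option (Center G ⊕ V)

namespace Node

/-- A center as a node. -/
abbrev center {G : SimpleGraph V} (s : Center G) : Node G := some (Sum.inl s)

/-- A vertex as a node. -/
abbrev vertex {G : SimpleGraph V} (v : V) : Node G := some (Sum.inr v)

end Node

variable {G}

open Classical in
/-- The center of the component of a central vertex. -/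
def centerOf {v : V} (h : IsCentral G v) : Center G := ⟨{v, inward G v}, v, h, rfl⟩

theorem mem_centerOf {v w : V} (h : IsCentral G v) :
    w ∈ (centerOf h).1 ↔ w = v ∨ w = inward G v := by
  simp [centerOf]

theorem self_mem_centerOf {v : V} (h : IsCentral G v) : v ∈ (centerOf h).1 :=
  (mem_centerOf h).mpr (Or.inl rfl)

/-- A central vertex in a center. -/
def Center.rep (s : Center G) : V := s.2.choose

theorem Center.isCentral_rep (s : Center G) : IsCentral G s.rep := s.2.choose_spec.1

theorem Center.eq_centerOf_rep (s : Center G) : s = centerOf s.isCentral_rep :=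
  Subtype.ext s.2.choose_spec.2

theorem Center.mem_iff (s : Center G) (v : V) : v ∈ s.1 ↔ v = s.rep ∨ v = inward G s.rep := by
  rw [← mem_centerOf s.isCentral_rep, ← s.eq_centerOf_rep]

theorem Center.isCentral (hG : G.IsAcyclic) {s : Center G} {v : V} (h : v ∈ s.1) :
    IsCentral G v := by
  rcases (s.mem_iff v).mp h with rfl | rfl
  · exact s.isCentral_rep
  · exact s.isCentral_rep.inward hG

theorem Center.inward_mem (hG : G.IsAcyclic) {s : Center G} {v : V} (h : v ∈ s.1) :
    inward G v ∈ s.1 := by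
  rw [s.mem_iff] at h ⊢
  rcases h with rfl | rfl
  · exact Or.inr rfl
  · exact Or.inl (s.isCentral_rep.inward_inward hG)

/-- Any member determines its center, so distinct centers are disjoint; orthogonality of center
entries in a row rests on this. -/
theorem Center.eq_centerOf (hG : G.IsAcyclic) {s : Center G} {v : V} (h : v ∈ s.1) :
    s = centerOf (s.isCentral hG h) := by
  refine Subtype.ext (Finset.ext fun w => ?_)
  rw [mem_centerOf, s.mem_iff]
  rcases (s.mem_iff v).mp h with h' | h'
  · rw [h']
  · rw [h', s.isCentral_rep.inward_inward hG, or_comm]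

variable (G) in
open Classical in
/-- The rooted tree of a forest. -/
def nodeTree : ParentTree (Node G) where
  parent
    | none => none
    | some (Sum.inl _) => none
    | some (Sum.inr v) => if h : IsCentral G v then Node.center (centerOf h)
        else Node.vertex (inward G v)
  root := none
  -- Eccentricity drops strictly along `inward` off the central vertices; the shift by `2` leaves
  -- room for the root and the centers.
  rank
    | none => 0
    | some (Sum.inl _) => 1
    | some (Sum.inr v) => ecc G v + 2
  parent_root := rfl
  rank_parent_lt
    | none, h => absurd rfl h
    | some (Sum.inl _), _ => Nat.zero_lt_one
    | some (Sum.inr v), _ => by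
      by_cases h : IsCentral G v
      · simp [h]
      · simpa [h] using lt_of_le_of_ne (ecc_inward_le v) h

theorem parent_vertex_of_isCentral {v : V} (h : IsCentral G v) :
    (nodeTree G).parent (Node.vertex v) = Node.center (centerOf h) := dif_pos h

theorem parent_vertex_of_not_isCentral {v : V} (h : ¬ IsCentral G v) :
    (nodeTree G).parent (Node.vertex v) = Node.vertex (inward G v) := dif_neg h

theorem parent_vertex_ne_none (v : V) : (nodeTree G).parent (Node.vertex v) ≠ none := by
  by_cases h : IsCentral G v
  · simp [parent_vertex_of_isCentral h]
  · simp [parent_vertex_of_not_isCentral h]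

theorem exists_eq_vertex {n : Node G} (h : (nodeTree G).parent n ≠ none) :
    ∃ v, n = Node.vertex v := by
  match n with
  | none => exact absurd rfl h
  | some (Sum.inl s) => exact absurd rfl h
  | some (Sum.inr v) => exact ⟨v, rfl⟩

theorem inward_eq_of_parent_eq {v w : V}
    (h : (nodeTree G).parent (Node.vertex v) = Node.vertex w) :
    inward G v = w ∧ ¬ IsCentral G v := by
  by_cases hv : IsCentral G v
  · simp [parent_vertex_of_isCentral hv] at h
  · rw [parent_vertex_of_not_isCentral hv] at h
    exact ⟨Sum.inr_injective (Option.some_injective _ h), hv⟩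

theorem adj_of_parent_eq {v w : V} (h : (nodeTree G).parent (Node.vertex v) = Node.vertex w) :
    G.Adj v w := by
  obtain ⟨rfl, hv⟩ := inward_eq_of_parent_eq h
  exact (adj_inward_or_eq v).resolve_right fun h' => hv (by rw [IsCentral, h'])

/-- The adjacency relation of a forest in terms of its rooted tree. -/
theorem adj_iff_nodeTree (hG : G.IsAcyclic) {v w : V} : G.Adj v w ↔
    (nodeTree G).parent (Node.vertex v) = Node.vertex w ∨
    (nodeTree G).parent (Node.vertex w) = Node.vertex v ∨
    ((Node.vertex v : Node G) ≠ Node.vertex w ∧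
      (nodeTree G).parent (Node.vertex v) = (nodeTree G).parent (Node.vertex w) ∧
      (nodeTree G).parent ((nodeTree G).parent (Node.vertex v)) = (nodeTree G).root) := by
  constructor
  · have key : ∀ {v w : V}, G.Adj v w → ecc G w ≤ ecc G v → ¬ IsCentral G v →
        (nodeTree G).parent (Node.vertex v) = Node.vertex w := by
      intro v w h hle hv
      rw [parent_vertex_of_not_isCentral hv, inward_eq hG h hle]
    intro h
    -- If the eccentricities of adjacent vertices differ, the larger one belongs to the child. If
    -- they agree, both vertices are central and form one center.
    rcases lt_trichotomy (ecc G w) (ecc G v) with hlt | heq | hlt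
    · refine Or.inl (key h hlt.le fun hv => ?_)
      rw [IsCentral, inward_eq hG h hlt.le] at hv
      omega
    · have e := inward_eq hG h heq.le
      have hv : IsCentral G v := by rw [IsCentral, e, heq]
      have hw : IsCentral G w := e ▸ hv.inward hG
      refine Or.inr (Or.inr ⟨fun h' => ?_, ?_, ?_⟩)
      · exact h.ne (Sum.inr_injective (Option.some_injective _ h'))
      · rw [parent_vertex_of_isCentral hv, parent_vertex_of_isCentral hw]
        refine congrArg Node.center (Center.eq_centerOf hG ?_)
        rw [mem_centerOf, e]
        exact Or.inr rfl
      · rw [parent_vertex_of_isCentral hv]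
        rfl
    · refine Or.inr (Or.inl (key h.symm hlt.le fun hw => ?_))
      rw [IsCentral, inward_eq hG h.symm hlt.le] at hw
      omega
  · rintro (h | h | ⟨hne, h, h'⟩)
    · exact adj_of_parent_eq h
    · exact (adj_of_parent_eq h).symm
    · have central : ∀ x, (nodeTree G).parent ((nodeTree G).parent (Node.vertex x)) =
          (nodeTree G).root → IsCentral G x := by
        intro x hx
        by_contra hc
        rw [parent_vertex_of_not_isCentral hc] at hx
        exact parent_vertex_ne_none _ hx
      have hv := central v h'
      have hw := central w (h ▸ h')
      rw [parent_vertex_of_isCentral hv, parent_vertex_of_isCentral hw] at h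
      have e : centerOf hv = centerOf hw := Sum.inl_injective (Option.some_injective _ h)
      have hm := self_mem_centerOf hw
      rw [← e, mem_centerOf] at hm
      have hwv : w ≠ v := fun h'' => hne (by rw [h''])
      have hi := hm.resolve_left hwv
      rw [hi]
      exact (adj_inward_or_eq v).resolve_right fun h'' => hwv (hi.trans h'')

variable {W : Type*} [Fintype W] {H : SimpleGraph W}

/-- An embedding of the rooted trees of forests of the same size comes from an isomorphism. -/
theorem exists_iso_of_isEmbedding (hG : G.IsAcyclic) (hH : H.IsAcyclic)
    (hc : Fintype.card V = Fintype.card W) {φ : Node G → Node H}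
    (hφ : ParentTree.IsEmbedding (nodeTree G) (nodeTree H) φ) :
    ∃ f : G ≃g H, ∀ v, φ (Node.vertex v) = Node.vertex (f v) := by
  have hv : ∀ v, ∃ w, φ (Node.vertex v) = Node.vertex w := by
    intro v
    -- Vertices are exactly the nodes whose parent is not the root, a property that an embedding
    -- preserves.
    refine exists_eq_vertex fun h => parent_vertex_ne_none (G := G) v (hφ.injective ?_)
    rw [hφ.parent, h]
    exact hφ.root.symm
  choose f hf using hv
  have hinj : Function.Injective f := by
    intro v w h
    have : (Node.vertex v : Node G) = Node.vertex w := hφ.injective (by rw [hf, hf, h])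
    exact Sum.inr_injective (Option.some_injective _ this)
  refine ⟨⟨Equiv.ofBijective f ((Fintype.bijective_iff_injective_and_card f).mpr ⟨hinj, hc⟩), ?_⟩,
    hf⟩
  intro v w
  -- Adjacency is expressed by equality, parents and the root, all of which an embedding preserves
  -- and reflects.
  rw [Equiv.ofBijective_apply, Equiv.ofBijective_apply, adj_iff_nodeTree hG, adj_iff_nodeTree hH,
    ← hf, ← hf, ← hφ.parent, ← hφ.parent, ← hφ.parent, ← hφ.root, hφ.injective.eq_iff,
    hφ.injective.eq_iff, hφ.injective.ne_iff, hφ.injective.eq_iff, hφ.injective.eq_iff]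

theorem isEmbedding_of_isAut {f : Equiv.Perm (Node G)} (hf : (nodeTree G).IsAut f) :
    ParentTree.IsEmbedding (nodeTree G) (nodeTree G) f where
  root := by
    refine (nodeTree G).eq_root_of_parent_eq ?_
    rw [← hf, ParentTree.parent_root]
  parent := hf
  injective := f.injective

/-- Nothing is lost by forgetting the centers: each is the parent of a vertex, so an automorphism
that fixes the vertices fixes every node. -/
theorem exists_iso_of_isAut (hG : G.IsAcyclic) {f : Equiv.Perm (Node G)}
    (hf : (nodeTree G).IsAut f) : ∃ g : G ≃g G, (∀ v, f (Node.vertex v) = Node.vertex (g v)) ∧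
      (f ≠ 1 → g ≠ SimpleGraph.Iso.refl) := by
  obtain ⟨g, hg⟩ := exists_iso_of_isEmbedding hG hG rfl (isEmbedding_of_isAut hf)
  refine ⟨g, hg, ?_⟩
  rintro hne rfl
  refine hne (Equiv.ext fun n => ?_)
  have hv : ∀ v, f (Node.vertex v) = Node.vertex v := hg
  match n with
  | none => exact (isEmbedding_of_isAut hf).root
  | some (Sum.inl s) =>
    have h := hf (Node.vertex s.rep)
    rw [hv, parent_vertex_of_isCentral s.isCentral_rep, ← s.eq_centerOf_rep] at h
    exact h
  | some (Sum.inr v) => exact hv v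

theorem schmidtCriterion_of_nodeTree (hG : G.IsAcyclic) (h : (nodeTree G).SchmidtCriterion) :
    SchmidtCriterion G := by
  obtain ⟨f, g, hf, hg, hf₁, hg₁, hd⟩ := h
  obtain ⟨f', hf', hf₁'⟩ := exists_iso_of_isAut hG hf
  obtain ⟨g', hg', hg₁'⟩ := exists_iso_of_isAut hG hg
  refine ⟨f', g', hf₁' hf₁, hg₁' hg₁, Set.disjoint_left.mpr fun v hv hv' => ?_⟩
  have inj : ∀ {x y : V}, (Node.vertex x : Node G) = Node.vertex y → x = y := fun h' =>
    Sum.inr_injective (Option.some_injective _ h')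
  rcases hd (Node.vertex v) with h' | h'
  · rw [hf'] at h'
    exact hv (inj h')
  · rw [hg'] at h'
    exact hv' (inj h')

theorem not_isTwin_of_isAsymmetric (hG : G.IsAcyclic) (h : IsAsymmetric G) (c d : Node G) :
    ¬ (nodeTree G).IsTwin c d := by
  intro ht
  obtain ⟨f, hf, hfc, -⟩ := ht.exists_isAut
  obtain ⟨g, -, hg⟩ := exists_iso_of_isAut hG hf
  exact hg (ParentTree.ne_one_of_apply_eq ht hfc) (h g)

end NodeTree

/-! ## Magic matrices that intertwine adjacency matrices -/

/-- A magic matrix that is compatible with the adjacency relations of two graphs. -/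
structure IsIntertwiner {V W A : Type*} [Fintype V] [Fintype W] [Ring A] (G : SimpleGraph V)
    (H : SimpleGraph W) (U : Matrix W V A) : Prop extends IsMagicMatrix U where
  adj_iff : ∀ i k j l, U i j * U k l ≠ 0 → (H.Adj i k ↔ G.Adj j l)

namespace IsIntertwiner

variable {V W A : Type*} [Fintype V] [Fintype W] [Ring A] {G : SimpleGraph V} {H : SimpleGraph W}
  {U : Matrix W V A}

/-- Multiply the entry `(i, l)` of the relation by `U i j` on the left and `U k l` on the right.
Orthogonality leaves `U i j * U k l` on each side, weighted by the respective adjacency coefficient.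
-/
theorem of_mul_adj (hU : IsMagicMatrix U) (h : U * adj G A = adj H A * U) :
    IsIntertwiner G H U where
  toIsMagicMatrix := hU
  adj_iff i k j l := by
    classical
    contrapose
    intro hne
    have e := congrFun (congrFun h i) l
    simp only [Matrix.mul_apply, adj, SimpleGraph.adjMatrix_apply, mul_ite, ite_mul, mul_one,
      mul_zero, one_mul, zero_mul] at e
    have e' := congrArg (fun x => U i j * x * U k l) e
    simp only [Finset.mul_sum, Finset.sum_mul] at e'
    rw [Finset.sum_eq_single j, Finset.sum_eq_single k] at e'
    · by_cases hjl : G.Adj j l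
      · have hik : ¬ H.Adj i k := fun h' => hne ⟨fun _ => hjl, fun _ => h'⟩
        simpa [hjl, hik, hU.mul_self] using e'
      · have hik : H.Adj i k := by
          by_contra h'
          exact hne ⟨fun h'' => absurd h'' h', fun h'' => absurd h'' hjl⟩
        simpa [hjl, hik, hU.mul_self, mul_assoc, eq_comm] using e'
    · intro b _ hb
      split_ifs
      · rw [mul_assoc, hU.col_mul _ _ _ hb, mul_zero]
      · simp
    · simp
    · intro b _ hb
      split_ifs
      · rw [hU.row_mul _ _ _ hb.symm, zero_mul]
      · simp
    · simp

variable (h : IsIntertwiner G H U)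
include h

theorem transpose : IsIntertwiner H G U.transpose where
  toIsMagicMatrix := h.toIsMagicMatrix.transpose
  adj_iff i k j l hne := (h.adj_iff j l i k hne).symm

theorem op : IsIntertwiner G H (Matrix.of fun i j => MulOpposite.op (U i j)) where
  toIsMagicMatrix := h.toIsMagicMatrix.op
  adj_iff i k j l hne := by
    rw [H.adj_comm, G.adj_comm]
    exact h.adj_iff k i l j fun h' => hne (congrArg MulOpposite.op h')

theorem exists_mul_ne_zero {i : W} {j : V} (hij : U i j ≠ 0) (l : V) : ∃ k, U i j * U k l ≠ 0 := by
  rw [← mul_one (U i j), ← h.col_sum l, Finset.mul_sum] at hij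
  obtain ⟨k, -, hk⟩ := Finset.exists_ne_zero_of_sum_ne_zero hij
  exact ⟨k, hk⟩

/-- Inserting a column sum between the two factors finds an image of the next vertex of the walk
that keeps the product nonzero. -/
theorem exists_walk {i k : W} {j l : V} (p : G.Walk j l) (hne : U i j * U k l ≠ 0) :
    ∃ q : H.Walk i k, q.length = p.length := by
  induction p generalizing i with
  | nil =>
    by_cases hik : i = k
    · subst hik
      exact ⟨.nil, rfl⟩
    · exact absurd (h.col_mul _ _ _ hik) hne
  | @cons j m l hjm p ih =>
    have hs : U i j * U k l = ∑ a, U i j * U a m * U k l := by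
      rw [← Finset.sum_mul, ← Finset.mul_sum, h.col_sum, mul_one]
    rw [hs] at hne
    obtain ⟨a, -, ha⟩ := Finset.exists_ne_zero_of_sum_ne_zero hne
    have h₁ : U i j * U a m ≠ 0 := left_ne_zero_of_mul ha
    rw [mul_assoc] at ha
    obtain ⟨q, hq⟩ := ih (right_ne_zero_of_mul ha)
    exact ⟨q.cons ((h.adj_iff _ _ _ _ h₁).mpr hjm), by simp [hq]⟩

theorem dist_le {i k : W} {j l : V} (hne : U i j * U k l ≠ 0) : G.dist j l ≤ H.dist i k := by
  by_cases hr : H.Reachable i k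
  · obtain ⟨p, hp⟩ := hr.exists_walk_length_eq_dist
    obtain ⟨q, hq⟩ := h.transpose.exists_walk p hne
    rw [← hp, ← hq]
    exact G.dist_le q
  · rw [SimpleGraph.dist_eq_zero_of_not_reachable]
    · exact Nat.zero_le _
    · rintro ⟨p⟩
      exact hr (h.exists_walk p hne).nonempty

theorem ecc_le {i : W} {j : V} (hne : U i j ≠ 0) : ecc G j ≤ ecc H i := by
  obtain ⟨l, hl⟩ := exists_dist_eq_ecc G j
  obtain ⟨k, hk⟩ := h.exists_mul_ne_zero hne l
  rw [← hl]
  exact (h.dist_le hk).trans (dist_le_ecc H i k)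

theorem ecc_eq {i : W} {j : V} (hne : U i j ≠ 0) : ecc H i = ecc G j :=
  (h.transpose.ecc_le hne).antisymm (h.ecc_le hne)

variable (hG : G.IsAcyclic) (hH : H.IsAcyclic)
include hG hH

/-- The product transports adjacency and its factors transport eccentricity, so an inward neighbour
of `i` matches only an inward neighbour of `j`, which is unique. If `i` has none, then `j = l`, and
an inward neighbour of `j` would produce one of `i`. -/
theorem eq_inward {i : W} {j l : V} (hne : U i j * U (inward H i) l ≠ 0) : l = inward G j := by
  have hij := left_ne_zero_of_mul hne
  have hil := right_ne_zero_of_mul hne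
  rcases adj_inward_or_eq (G := H) i with hi | hi
  · refine (inward_eq hG ((h.adj_iff _ _ _ _ hne).mp hi) ?_).symm
    rw [← h.ecc_eq hij, ← h.ecc_eq hil]
    exact ecc_inward_le i
  · rw [hi] at hne
    have hjl : j = l := by
      by_contra h'
      exact hne (h.row_mul _ _ _ h')
    rcases adj_inward_or_eq (G := G) j with hj | hj
    · exfalso
      obtain ⟨k, hk⟩ := h.exists_mul_ne_zero hij (inward G j)
      have hik := (h.adj_iff _ _ _ _ hk).mpr hj
      have := inward_eq hH hik (by
        rw [h.ecc_eq hij, h.ecc_eq (right_ne_zero_of_mul hk)]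
        exact ecc_inward_le j)
      rw [hi] at this
      exact hik.ne this
    · rw [hj, hjl]

theorem mul_inward (i : W) (j : V) : U i j * U (inward H i) (inward G j) = U i j := by
  have hs : ∑ l, U i j * U (inward H i) l = U i j := by
    rw [← Finset.mul_sum, h.row_sum, mul_one]
  rwa [Finset.sum_eq_single (inward G j)] at hs
  · intro l _ hl
    by_contra hne
    exact hl (h.eq_inward hG hH hne)
  · simp

theorem inward_mul (i : W) (j : V) : U (inward H i) (inward G j) * U i j = U i j :=
  congrArg MulOpposite.unop (h.op.mul_inward hG hH i j)

theorem isCentral_iff {i : W} {j : V} (hne : U i j ≠ 0) : IsCentral H i ↔ IsCentral G j := by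
  have hne' : U (inward H i) (inward G j) ≠ 0 := by
    rw [← h.mul_inward hG hH] at hne
    exact right_ne_zero_of_mul hne
  rw [IsCentral, IsCentral, h.ecc_eq hne, h.ecc_eq hne']

/-- On central vertices `inward` is an involution, so each of the two entries absorbs the other. -/
theorem apply_inward {i : W} {j : V} (hi : IsCentral H i) (hj : IsCentral G j) :
    U (inward H i) (inward G j) = U i j := by
  have h₁ := h.mul_inward hG hH (inward H i) (inward G j)
  rwa [hi.inward_inward hH, hj.inward_inward hG, h.inward_mul hG hH, eq_comm] at h₁

theorem sum_center_inward {i : W} (hi : IsCentral H i) (t : Center G) :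
    ∑ j ∈ t.1, U (inward H i) j = ∑ j ∈ t.1, U i j := by
  refine Finset.sum_nbij' (inward G) (inward G) (fun j hj => t.inward_mem hG hj)
    (fun j hj => t.inward_mem hG hj) (fun j hj => (t.isCentral hG hj).inward_inward hG)
    (fun j hj => (t.isCentral hG hj).inward_inward hG) fun j hj => ?_
  rw [← h.apply_inward hG hH (hi.inward hH) (t.isCentral hG hj), hi.inward_inward hH]

/-- The entry of `nodeMatrix` at two centers does not depend on the chosen representative. -/
theorem sum_center_rep {s : Center H} {i : W} (hi : i ∈ s.1) (t : Center G) :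
    ∑ j ∈ t.1, U s.rep j = ∑ j ∈ t.1, U i j := by
  rcases (s.mem_iff i).mp hi with rfl | rfl
  · rfl
  · exact (h.sum_center_inward hG hH s.isCentral_rep t).symm

/-- For two centers of two vertices, `apply_inward` matches the off-diagonal entries. For a center
of one vertex against one of two, it equates two orthogonal idempotents, which are therefore zero.
-/
theorem sum_centerOf {i : W} {j : V} (hi : IsCentral H i) (hj : IsCentral G j) :
    ∑ l ∈ (centerOf hj).1, U i l = ∑ k ∈ (centerOf hi).1, U k j := by
  classical
  have h₁ : ∑ l ∈ (centerOf hj).1, U i l =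
      if inward G j = j then U i j else U i j + U i (inward G j) := by
    have : (centerOf hj).1 = {j, inward G j} := rfl
    split_ifs with h'
    · rw [this, h']; simp
    · rw [this, Finset.sum_pair (Ne.symm h')]
  have h₂ : ∑ k ∈ (centerOf hi).1, U k j =
      if inward H i = i then U i j else U i j + U (inward H i) j := by
    have : (centerOf hi).1 = {i, inward H i} := rfl
    split_ifs with h'
    · rw [this, h']; simp
    · rw [this, Finset.sum_pair (Ne.symm h')]
  have e := h.apply_inward hG hH hi hj
  have e' := h.apply_inward hG hH (hi.inward hH) hj
  rw [hi.inward_inward hH] at e'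
  rw [h₁, h₂, ← e']
  split_ifs with hj' hi' hi'
  · rfl
  · have h₀ := h.col_mul _ j _ hi'
    rw [hj'] at e
    rw [e, h.mul_self] at h₀
    simp [hj', h₀]
  · have h₀ := h.row_mul i _ _ hj'
    rw [hi'] at e
    rw [e, h.mul_self] at h₀
    simp [e, h₀]
  · rfl

end IsIntertwiner

/-! ### The magic matrix on the nodes -/

variable {V W A : Type*} [Fintype V] [Fintype W] [Ring A] {G : SimpleGraph V} {H : SimpleGraph W}

/-- The extension of a matrix from the vertices of forests to the nodes of their rooted trees. -/
def nodeMatrix (G : SimpleGraph V) (H : SimpleGraph W) (U : Matrix W V A) :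
    Matrix (Node H) (Node G) A :=
  Matrix.of fun
    | none, none => 1
    | some (Sum.inl s), some (Sum.inl t) => ∑ j ∈ t.1, U s.rep j
    | some (Sum.inr i), some (Sum.inr j) => U i j
    | _, _ => 0

namespace IsIntertwiner

variable {U : Matrix W V A} (h : IsIntertwiner G H U) (hG : G.IsAcyclic) (hH : H.IsAcyclic)
include h hG hH

/-- The definition sums over a row; this symmetry reduces the column relations to the row relations.
-/
theorem nodeMatrix_transpose :
    (nodeMatrix G H U).transpose = nodeMatrix H G U.transpose := by
  ext n m
  match n, m with
  | none, none => rfl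
  | none, some (Sum.inl _) => rfl
  | none, some (Sum.inr _) => rfl
  | some (Sum.inl _), none => rfl
  | some (Sum.inr _), none => rfl
  | some (Sum.inl _), some (Sum.inr _) => rfl
  | some (Sum.inr _), some (Sum.inl _) => rfl
  | some (Sum.inr _), some (Sum.inr _) => rfl
  | some (Sum.inl t), some (Sum.inl s) =>
    have e := h.sum_centerOf hG hH s.isCentral_rep t.isCentral_rep
    rw [← s.eq_centerOf_rep, ← t.eq_centerOf_rep] at e
    exact e

omit hG hH in
theorem nodeMatrix_mul_self (n : Node H) (m : Node G) :
    nodeMatrix G H U n m * nodeMatrix G H U n m = nodeMatrix G H U n m := by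
  classical
  match n, m with
  | none, none => exact mul_one _
  | none, some (Sum.inl _) => exact mul_zero _
  | none, some (Sum.inr _) => exact mul_zero _
  | some (Sum.inl _), none => exact mul_zero _
  | some (Sum.inr _), none => exact mul_zero _
  | some (Sum.inl _), some (Sum.inr _) => exact mul_zero _
  | some (Sum.inr _), some (Sum.inl _) => exact mul_zero _
  | some (Sum.inr i), some (Sum.inr j) => exact h.mul_self i j
  | some (Sum.inl s), some (Sum.inl t) =>
    change (∑ j ∈ t.1, U s.rep j) * (∑ j ∈ t.1, U s.rep j) = ∑ j ∈ t.1, U s.rep j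
    rw [Finset.sum_mul_sum]
    refine Finset.sum_congr rfl fun j hj => ?_
    rw [Finset.sum_eq_single_of_mem j hj, h.mul_self]
    exact fun l _ hl => h.row_mul _ _ _ hl.symm

theorem nodeMatrix_row_sum (n : Node H) : ∑ m, nodeMatrix G H U n m = 1 := by
  classical
  rw [Fintype.sum_option, Fintype.sum_sum_type]
  match n with
  | none => simp [nodeMatrix]
  | some (Sum.inr i) => simp [nodeMatrix, h.row_sum]
  | some (Sum.inl s) =>
    simp only [nodeMatrix, Matrix.of_apply, Finset.sum_const_zero, zero_add, add_zero]
    rw [← h.row_sum s.rep]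
    have e : ∀ t : Center G, ∑ j ∈ t.1, U s.rep j = ∑ j, if j ∈ t.1 then U s.rep j else 0 :=
      fun t => by rw [← Finset.sum_filter]; exact Finset.sum_congr (by ext; simp) fun _ _ => rfl
    simp only [e]
    rw [Finset.sum_comm]
    refine Finset.sum_congr rfl fun j _ => ?_
    by_cases hj : IsCentral G j
    · rw [Finset.sum_eq_single (centerOf hj), if_pos (self_mem_centerOf hj)]
      · intro t _ ht
        rw [if_neg]
        exact fun h' => ht (t.eq_centerOf hG h')
      · simp
    -- Vertices outside all centers do not contribute, as nonzero entries preserve centrality.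
    · have h₀ : U s.rep j = 0 := by
        by_contra hne
        exact hj ((h.isCentral_iff hG hH hne).mp s.isCentral_rep)
      simp [h₀]

omit hH in
theorem nodeMatrix_row_mul (n : Node H) (m m' : Node G) (hm : m ≠ m') :
    nodeMatrix G H U n m * nodeMatrix G H U n m' = 0 := by
  match n, m, m' with
  | none, none, none => exact absurd rfl hm
  | none, some (Sum.inl _), _ => exact zero_mul _
  | none, some (Sum.inr _), _ => exact zero_mul _
  | none, none, some (Sum.inl _) => exact mul_zero _
  | none, none, some (Sum.inr _) => exact mul_zero _
  | some (Sum.inl _), none, _ => exact zero_mul _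
  | some (Sum.inl _), some (Sum.inr _), _ => exact zero_mul _
  | some (Sum.inl _), some (Sum.inl _), none => exact mul_zero _
  | some (Sum.inl _), some (Sum.inl _), some (Sum.inr _) => exact mul_zero _
  | some (Sum.inr _), none, _ => exact zero_mul _
  | some (Sum.inr _), some (Sum.inl _), _ => exact zero_mul _
  | some (Sum.inr _), some (Sum.inr _), none => exact mul_zero _
  | some (Sum.inr _), some (Sum.inr _), some (Sum.inl _) => exact mul_zero _
  | some (Sum.inr i), some (Sum.inr j), some (Sum.inr l) =>
    exact h.row_mul i j l fun h' => hm (by rw [h'])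
  | some (Sum.inl s), some (Sum.inl t), some (Sum.inl t') =>
    change (∑ j ∈ t.1, U s.rep j) * (∑ j ∈ t'.1, U s.rep j) = 0
    rw [Finset.sum_mul_sum]
    refine Finset.sum_eq_zero fun j hj => Finset.sum_eq_zero fun l hl => h.row_mul _ _ _ ?_
    rintro rfl
    exact hm (by rw [t.eq_centerOf hG hj, t'.eq_centerOf hG hl])

theorem isMagicMatrix_nodeMatrix : IsMagicMatrix (nodeMatrix G H U) where
  mul_self := h.nodeMatrix_mul_self
  row_sum := h.nodeMatrix_row_sum hG hH
  row_mul := h.nodeMatrix_row_mul hG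
  col_sum m := by
    have := h.transpose.nodeMatrix_row_sum hH hG m
    rwa [← h.nodeMatrix_transpose hG hH] at this
  col_mul n m n' hn := by
    have := h.transpose.nodeMatrix_row_mul hH m n n' hn
    rwa [← h.nodeMatrix_transpose hG hH] at this

theorem isTreeMagic_nodeMatrix : IsTreeMagic (nodeTree H) (nodeTree G) (nodeMatrix G H U) where
  toIsMagicMatrix := h.isMagicMatrix_nodeMatrix hG hH
  root := rfl
  mul_parent n m := by
    classical
    match n, m with
    | none, none => exact mul_one _
    | none, some (Sum.inl _) => exact zero_mul _
    | none, some (Sum.inr _) => exact zero_mul _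
    | some (Sum.inl _), none => exact zero_mul _
    | some (Sum.inr _), none => exact zero_mul _
    | some (Sum.inl _), some (Sum.inr _) => exact zero_mul _
    | some (Sum.inr _), some (Sum.inl _) => exact zero_mul _
    | some (Sum.inl s), some (Sum.inl t) => exact mul_one _
    | some (Sum.inr i), some (Sum.inr j) =>
      by_cases hU : U i j = 0
      · have : nodeMatrix G H U (Node.vertex i) (Node.vertex j) = 0 := hU
        rw [this, zero_mul]
      have hc := h.isCentral_iff hG hH hU
      by_cases hj : IsCentral G j
      · have hi := hc.mpr hj
        rw [parent_vertex_of_isCentral hi, parent_vertex_of_isCentral hj]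
        -- The entry at the two centers is a sum along row `i` that contains `U i j`.
        change U i j * ∑ l ∈ (centerOf hj).1, U (centerOf hi).rep l = U i j
        rw [h.sum_center_rep hG hH (self_mem_centerOf hi), Finset.mul_sum,
          Finset.sum_eq_single_of_mem j (self_mem_centerOf hj), h.mul_self]
        exact fun l _ hl => h.row_mul _ _ _ hl.symm
      · rw [parent_vertex_of_not_isCentral (fun hi => hj (hc.mp hi)),
          parent_vertex_of_not_isCentral hj]
        exact h.mul_inward hG hH i j

/-- Forests that are related by a magic matrix are isomorphic. -/
theorem nonempty_iso [Algebra ℂ A] [Nontrivial A] (hc : Fintype.card V = Fintype.card W) :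
    Nonempty (G ≃g H) := by
  have ht := h.isTreeMagic_nodeMatrix hG hH
  -- The root entry `1` is nonzero because the algebra is; this alone makes the trees isomorphic.
  have hr : (nodeTree G).code (nodeTree G).root = (nodeTree H).code (nodeTree H).root :=
    (ht.code_eq (by rw [ht.root]; exact one_ne_zero)).symm
  obtain ⟨φ, hφ⟩ := ParentTree.exists_isEmbedding hr
  obtain ⟨f, -⟩ := exists_iso_of_isEmbedding hG hH hc hφ
  exact ⟨f⟩

end IsIntertwiner

/-! ### Magic matrices on one forest -/

namespace IsIntertwiner

variable [Algebra ℂ A] {U : Matrix V V A} (h : IsIntertwiner G G U) (hG : G.IsAcyclic)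
include h hG

theorem eq_one_of_isAsymmetric [DecidableEq V] (ha : IsAsymmetric G) : U = 1 := by
  have hd : ∀ i, U i i = 1 := fun i =>
    (h.isTreeMagic_nodeMatrix hG hG).diag_eq_one (n := Node.vertex i) fun c _ d =>
      not_isTwin_of_isAsymmetric hG ha c d
  ext i j
  by_cases hij : i = j
  · rw [hij, hd, Matrix.one_apply_eq]
  · rw [Matrix.one_apply_ne hij, ← one_mul (U i j), ← hd i, h.row_mul _ _ _ hij]

theorem commute_of_not_schmidtCriterion (hS : ¬ SchmidtCriterion G) (i j k l : V) :
    Commute (U i j) (U k l) :=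
  (h.isTreeMagic_nodeMatrix hG hG).commute (fun h' => hS (schmidtCriterion_of_nodeTree hG h'))
    (Node.vertex i) (Node.vertex j) (Node.vertex k) (Node.vertex l)

end IsIntertwiner

/-! ## Permutation matrices and characters -/

open Classical in
/-- The permutation matrix of a bijection. -/
def permMatrix {V W : Type*} (A : Type*) [Ring A] (f : V ≃ W) : Matrix W V A :=
  Matrix.of fun i j => if i = f j then 1 else 0

section permMatrix

variable {V W A : Type*} [Fintype V] [Fintype W] [Ring A]

omit [Fintype W] in
theorem sum_ite_eq_apply (f : V ≃ W) [DecidableEq W] (i : W) (a : A) :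
    ∑ j, (if i = f j then a else 0) = a := by
  rw [Finset.sum_eq_single (f.symm i)]
  · simp
  · intro j _ hj
    exact if_neg fun h => hj ((Equiv.symm_apply_eq f).mpr h).symm
  · simp

theorem permMatrix_isMagic [StarRing A] (f : V ≃ W) : IsMagic (permMatrix A f) where
  card_eq := (Fintype.card_congr f).symm
  star_eq i j := by simp only [permMatrix, Matrix.of_apply]; split_ifs <;> simp
  mul_self i j := by simp only [permMatrix, Matrix.of_apply]; split_ifs <;> simp
  row_sum i := by
    classical
    exact sum_ite_eq_apply f i 1
  col_sum j := by
    classical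
    simp only [permMatrix, Matrix.of_apply, Finset.sum_ite_eq', Finset.mem_univ, if_true]
  row_mul i j k h := by
    simp only [permMatrix, Matrix.of_apply]
    split_ifs with h₁ h₂
    · exact absurd (f.injective (h₁.symm.trans h₂)) h
    all_goals simp
  col_mul i j k h := by
    simp only [permMatrix, Matrix.of_apply]
    split_ifs with h₁ h₂
    · exact absurd (h₁.trans h₂.symm) h
    all_goals simp

theorem permMatrix_mul_adj {G : SimpleGraph V} {H : SimpleGraph W} (f : G ≃g H) :
    permMatrix A f.toEquiv * adj G A = adj H A * permMatrix A f.toEquiv := by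
  classical
  ext i j
  simp only [Matrix.mul_apply, permMatrix, adj, Matrix.of_apply, SimpleGraph.adjMatrix_apply,
    ← Equiv.symm_apply_eq, ite_mul, one_mul, zero_mul, Finset.sum_ite_eq, Finset.mem_univ, if_true]
  rw [Finset.sum_eq_single (f j)]
  · have h : G.Adj (f.symm i) j ↔ H.Adj i (f j) := by
      rw [← f.map_adj_iff, f.apply_symm_apply]
    have h' : f.toEquiv.symm i = f.symm i := rfl
    have h'' : f.toEquiv.symm (f j) = j := f.symm_apply_apply j
    simp [h, h', h'']
  · intro k _ hk
    have : f.toEquiv.symm k ≠ j := fun h => hk ((Equiv.symm_apply_eq _).mp h)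
    simp [this]
  · simp

end permMatrix

theorem quantumIsomorphic_of_iso {V W : Type u} [Fintype V] [Fintype W] {G : SimpleGraph V}
    {H : SimpleGraph W} (f : G ≃g H) : QuantumIsomorphic.{u, u, w} G H :=
  -- This is `ℂ`, placed in the required universe.
  ⟨PUnit.{w + 1} → ℂ, inferInstance, inferInstance, permMatrix _ f.toEquiv,
    permMatrix_isMagic _, permMatrix_mul_adj f⟩

/-! ### Characters and generators of the algebra of coefficients -/

section Coefficients

variable {V : Type u} [Fintype V] {G : SimpleGraph V}

/-- The homomorphism on the algebra of coefficients given by a magic unitary adapted to the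
graph. -/
def coeffLift {B : Type v} [Ring B] [StarRing B] [Algebra ℂ B] [StarModule ℂ B]
    (U : Matrix V V B) (hU : IsMagic U) (hG : U * adj G B = adj G B * U) : (Qu G).Coeff →⋆ₐ[ℂ] B :=
  UniversalStarAlgebra.lift (fun ij : V × V => U ij.1 ij.2) (quRel_eval G U hU hG.symm)

theorem coeffLift_p {B : Type v} [Ring B] [StarRing B] [Algebra ℂ B] [StarModule ℂ B]
    (U : Matrix V V B) (hU : IsMagic U) (hG : U * adj G B = adj G B * U) (i j : V) :
    coeffLift U hU hG ((Qu G).p i j) = U i j :=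
  UniversalStarAlgebra.lift_gen (fun ij : V × V => U ij.1 ij.2) (quRel_eval G U hU hG.symm) (i, j)

/-- The character of the algebra of coefficients at an automorphism of the graph. -/
def character (f : G ≃g G) : (Qu G).Coeff →⋆ₐ[ℂ] ℂ :=
  coeffLift (permMatrix ℂ f.toEquiv) (permMatrix_isMagic _) (permMatrix_mul_adj f)

theorem character_p (f : G ≃g G) (i j : V) :
    character f ((Qu G).p i j) = permMatrix ℂ f.toEquiv i j := coeffLift_p _ _ _ i j

theorem isIntertwiner_p (G : SimpleGraph V) : IsIntertwiner G G (Qu G).p :=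
  IsIntertwiner.of_mul_adj (Qu G).isMagic.isMagicMatrix (fundRep_adj G).symm

/-- An algebra of scalars has only one character, whereas the characters of `f` and of the identity
differ at the generator `(f j, j)` as soon as `f` moves `j`. -/
theorem isAsymmetric_of_isTrivial (h : (Qu G).IsTrivial) : IsAsymmetric G := by
  obtain ⟨e, -⟩ := h
  intro f
  have key : ∀ (χ : (Qu G).Coeff →⋆ₐ[ℂ] ℂ) (a : (Qu G).Coeff), χ a = e a := by
    intro χ a
    let z : ℂ := e a
    have ha : a = algebraMap ℂ (Qu G).Coeff z := by
      apply EquivLike.injective e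
      exact (AlgHomClass.commutes
        (e : (Qu G).Coeff →⋆ₐ[ℂ] QuantumPermutationGroup.one.Coeff) z).symm
    conv_lhs => rw [ha]
    exact AlgHomClass.commutes χ z
  refine RelIso.ext fun j => ?_
  have h₁ := (key (character f) ((Qu G).p (f j) j)).trans
    (key (character SimpleGraph.Iso.refl) ((Qu G).p (f j) j)).symm
  rw [character_p, character_p] at h₁
  by_contra hne
  have h₂ : permMatrix ℂ f.toEquiv (f j) j = 1 := if_pos rfl
  have h₃ : permMatrix ℂ (SimpleGraph.Iso.refl : G ≃g G).toEquiv (f j) j = 0 := if_neg hne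
  rw [h₂, h₃] at h₁
  exact one_ne_zero h₁

/-- Scalar generators force all coefficients to be scalars. The character of the identity is then an
isomorphism onto `ℂ`, and unital homomorphisms agree on scalars, so compatibility with
comultiplications is automatic. -/
theorem isTrivial_of_forall_p {G : SimpleGraph V}
    (h : ∀ i j, (Qu G).p i j = 0 ∨ (Qu G).p i j = 1) : (Qu G).IsTrivial := by
  have scalar : ∀ a : (Qu G).Coeff, ∃ z : ℂ, algebraMap ℂ (Qu G).Coeff z = a := by
    intro a
    have ha : a ∈ StarAlgebra.adjoin ℂ (Set.range fun ij : V × V => (Qu G).p ij.1 ij.2) := by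
      rw [(Qu G).adjoin_eq_top]
      trivial
    have hle : StarAlgebra.adjoin ℂ (Set.range fun ij : V × V => (Qu G).p ij.1 ij.2) ≤
        (⊥ : StarSubalgebra ℂ (Qu G).Coeff) := by
      refine StarAlgebra.adjoin_le ?_
      rintro _ ⟨ij, rfl⟩
      rcases h ij.1 ij.2 with h' | h'
      · simp only [h']; exact zero_mem _
      · simp only [h']; exact one_mem _
    exact StarSubalgebra.mem_bot.mp (hle ha)
  let ε : (Qu G).Coeff →⋆ₐ[ℂ] ℂ := character SimpleGraph.Iso.refl
  have hε : ∀ z : ℂ, ε (algebraMap ℂ (Qu G).Coeff z) = z := fun z => AlgHomClass.commutes ε z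
  have bij : Function.Bijective ε := by
    constructor
    · intro a b hab
      obtain ⟨z, rfl⟩ := scalar a
      obtain ⟨y, rfl⟩ := scalar b
      rw [hε, hε] at hab
      rw [hab]
    · exact fun z => ⟨_, hε z⟩
  refine ⟨StarAlgEquiv.ofBijective ε bij, fun a => ?_⟩
  obtain ⟨z, rfl⟩ := scalar a
  have h₁ : ∀ f : (Qu G).Coeff →⋆ₐ[ℂ] QuantumPermutationGroup.one.Coeff,
      QuantumPermutationGroup.one.comul (f (algebraMap ℂ _ z)) = algebraMap ℂ _ z := by
    intro f
    rw [AlgHomClass.commutes f, AlgHomClass.commutes QuantumPermutationGroup.one.comul]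
  have h₂ : ∀ f : (Qu G).Coeff →ₐ[ℂ] QuantumPermutationGroup.one.Coeff,
      Algebra.TensorProduct.map f f ((Qu G).comul (algebraMap ℂ _ z)) = algebraMap ℂ _ z := by
    intro f
    rw [AlgHomClass.commutes (Qu G).comul, AlgHomClass.commutes (Algebra.TensorProduct.map f f)]
  exact (h₁ _).trans (h₂ _).symm

theorem not_hasQuantumSymmetry_of_commute {G : SimpleGraph V}
    (h : ∀ i j k l, Commute ((Qu G).p i j) ((Qu G).p k l)) : ¬ HasQuantumSymmetry G := by
  rintro ⟨a, b, hab⟩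
  let S : Set (Qu G).Coeff := Set.range fun ij : V × V => (Qu G).p ij.1 ij.2
  have comm : ∀ x ∈ S, ∀ y ∈ S, x * y = y * x := by
    rintro _ ⟨ij, rfl⟩ _ ⟨kl, rfl⟩
    exact h _ _ _ _
  have hstar : ∀ x ∈ S, ∀ y ∈ S, x * star y = star y * x := by
    rintro _ ⟨ij, rfl⟩ _ ⟨kl, rfl⟩
    simp only [(Qu G).isMagic.star_eq]
    exact h _ _ _ _
  have ha : ∀ x, x ∈ StarAlgebra.adjoin ℂ S := by
    intro x
    rw [(Qu G).adjoin_eq_top]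
    trivial
  have hc := StarAlgebra.isMulCommutative_adjoin ℂ comm hstar
  exact hab (congrArg Subtype.val
    (hc.is_comm.comm (⟨a, ha a⟩ : StarAlgebra.adjoin ℂ S) ⟨b, ha b⟩))

end Coefficients

/-! ## Schmidt's criterion -/

section Schmidt

variable {V A : Type*} [Fintype V] [Ring A]

open Classical in
/-- The matrix `permMatrix f * p + (1 - p)`. -/
def interpolation (f : V ≃ V) (p : A) : Matrix V V A :=
  Matrix.of fun i j => (if i = f j then p else 0) + if i = j then 1 - p else 0

omit [Fintype V] in
theorem interpolation_apply_self {f : V ≃ V} (p : A) {x : V} (h : f x ≠ x) :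
    interpolation f p (f x) x = p := by
  simp [interpolation, h]

theorem interpolation_row_sum (f : V ≃ V) (p : A) (i : V) : ∑ j, interpolation f p i j = 1 := by
  classical
  simp only [interpolation, Matrix.of_apply, Finset.sum_add_distrib, sum_ite_eq_apply,
    Finset.sum_ite_eq, Finset.mem_univ, if_true, add_sub_cancel]

theorem interpolation_col_sum (f : V ≃ V) (p : A) (j : V) : ∑ i, interpolation f p i j = 1 := by
  classical
  simp only [interpolation, Matrix.of_apply, Finset.sum_add_distrib, Finset.sum_ite_eq',
    Finset.mem_univ, if_true, add_sub_cancel]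

theorem interpolation_mul_adj {G : SimpleGraph V} (f : G ≃g G) (p : A) :
    interpolation f.toEquiv p * adj G A = adj G A * interpolation f.toEquiv p := by
  classical
  have e : interpolation f.toEquiv p = permMatrix A f.toEquiv * Matrix.diagonal (fun _ => p) +
      Matrix.diagonal (fun _ => 1 - p) := by
    ext i j
    simp only [interpolation, permMatrix, Matrix.of_apply, Matrix.add_apply, Matrix.mul_diagonal,
      Matrix.diagonal_apply, ite_mul, one_mul, zero_mul]
  have hd : ∀ a : A, Matrix.diagonal (fun _ => a) * adj G A =
      adj G A * Matrix.diagonal (fun _ => a) := by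
    intro a
    ext i j
    simp only [adj, Matrix.diagonal_mul, Matrix.mul_diagonal, SimpleGraph.adjMatrix_apply]
    split_ifs <;> simp
  rw [e, add_mul, mul_add, hd, mul_assoc, hd, ← mul_assoc, permMatrix_mul_adj, mul_assoc]

variable {f g : V ≃ V} (hfg : ∀ x, f x = x ∨ g x = x)
include hfg

-- As the supports are disjoint, each column of the product is a column of one of the two factors.
open Classical in
theorem interpolation_mul_apply (p q : A) (i j : V) :
    (interpolation f p * interpolation g q) i j =
      if g j = j then interpolation f p i j else interpolation g q i j := by
  classical
  have h : (interpolation f p * interpolation g q) i j =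
      interpolation f p i (g j) * q + interpolation f p i j * (1 - q) := by
    rw [Matrix.mul_apply]
    have : ∀ k, interpolation f p i k * interpolation g q k j =
        (if k = g j then interpolation f p i k * q else 0) +
          if k = j then interpolation f p i k * (1 - q) else 0 := by
      intro k
      conv_lhs => rw [interpolation.eq_def g q]
      simp only [Matrix.of_apply, mul_add, mul_ite, mul_zero]
    simp only [this, Finset.sum_add_distrib, Finset.sum_ite_eq', Finset.mem_univ, if_true]
  rw [h]
  split_ifs with hj
  · rw [hj, ← mul_add, add_sub_cancel, mul_one]
  · have h₁ : f j = j := (hfg j).resolve_right hj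
    have h₂ : f (g j) = g j := (hfg (g j)).resolve_right fun h' => hj (g.injective h')
    simp only [interpolation, Matrix.of_apply, h₁, h₂]
    split_ifs <;> simp

/-- No relation between `p` and `q` is needed: a nonzero product of two entries in one row or column
never mixes the two interpolations. -/
theorem interpolation_mul_isMagic [StarRing A] {p q : A} (hp : IsStarProjection p)
    (hq : IsStarProjection q) : IsMagic (interpolation f p * interpolation g q) := by
  classical
  have hp₁ : p * p = p := hp.isIdempotentElem
  have hq₁ : q * q = q := hq.isIdempotentElem
  have hp₂ : star p = p := hp.isSelfAdjoint
  have hq₂ : star q = q := hq.isSelfAdjoint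
  have zero : ∀ {P Q : Prop} [Decidable P] [Decidable Q] (a b : A), (P → Q → a * b = 0) →
      (if P then a else 0) * (if Q then b else 0) = 0 := by
    intro P Q _ _ a b h
    split_ifs with hP hQ
    · exact h hP hQ
    all_goals simp
  have one : ∀ (f : V ≃ V) {p : A}, p * p = p → star p = p → ∀ i j,
      star (interpolation f p i j) = interpolation f p i j ∧
      interpolation f p i j * interpolation f p i j = interpolation f p i j ∧
      (∀ k, j ≠ k → interpolation f p i j * interpolation f p i k = 0) ∧
      (∀ k, i ≠ k → interpolation f p i j * interpolation f p k j = 0) := by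
    intro f p hp hp' i j
    have h₁ : p * (1 - p) = 0 := by rw [mul_sub, mul_one, hp, sub_self]
    have h₂ : (1 - p) * p = 0 := by rw [sub_mul, one_mul, hp, sub_self]
    have h₃ : (1 - p) * (1 - p) = 1 - p := by rw [mul_sub, mul_one, h₂, sub_zero]
    refine ⟨?_, ?_, fun k hk => ?_, fun k hk => ?_⟩
    · simp only [interpolation, Matrix.of_apply]
      split_ifs <;> simp [hp']
    · simp only [interpolation, Matrix.of_apply]
      split_ifs <;> simp [hp, h₃]
    · have hf : f j ≠ f k := fun h => hk (f.injective h)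
      simp only [interpolation, Matrix.of_apply, add_mul, mul_add]
      rw [zero _ _ fun h h' => absurd (h.symm.trans h') hf, zero _ _ fun _ _ => h₂,
        zero _ _ fun _ _ => h₁, zero _ _ fun h h' => absurd (h.symm.trans h') hk]
      simp
    · simp only [interpolation, Matrix.of_apply, add_mul, mul_add]
      rw [zero _ _ fun h h' => absurd (h.trans h'.symm) hk, zero _ _ fun _ _ => h₂,
        zero _ _ fun _ _ => h₁, zero _ _ fun h h' => absurd (h.trans h'.symm) hk]
      simp
  -- The index `i` is fixed by `f` or by `g`, and the interpolation of a map that fixes `i` is zero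
  -- in row `i` off the diagonal.
  have cross : ∀ i j k, g j ≠ j → g k = k →
      interpolation f p i k = 0 ∨ interpolation g q i j = 0 := by
    intro i j k hj hk
    by_cases hi : g i = i
    · right
      have h₁ : i ≠ g j := fun h => hj (g.injective (by rw [← h, hi]))
      have h₂ : i ≠ j := fun h => hj (h ▸ hi)
      simp [interpolation, h₁, h₂]
    · left
      have h₁ : f i = i := (hfg i).resolve_right hi
      have h₂ : i ≠ k := fun h => hi (h ▸ hk)
      have h₃ : i ≠ f k := fun h => h₂ (f.injective (by rw [h₁, ← h]))
      simp [interpolation, h₂, h₃]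
  refine ⟨rfl, fun i j => ?_, fun i j => ?_, fun i => ?_, fun j => ?_, fun i j k h => ?_,
    fun i j k h => ?_⟩
  · rw [interpolation_mul_apply hfg]
    split_ifs
    · exact (one f hp₁ hp₂ i j).1
    · exact (one g hq₁ hq₂ i j).1
  · rw [interpolation_mul_apply hfg]
    split_ifs
    · exact (one f hp₁ hp₂ i j).2.1
    · exact (one g hq₁ hq₂ i j).2.1
  · simp only [Matrix.mul_apply]
    rw [Finset.sum_comm]
    simp only [← Finset.mul_sum, interpolation_row_sum, mul_one]
  · simp only [Matrix.mul_apply]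
    rw [Finset.sum_comm]
    simp only [← Finset.sum_mul, interpolation_col_sum, one_mul]
  · rw [interpolation_mul_apply hfg, interpolation_mul_apply hfg]
    split_ifs with hj hk hk
    · exact (one f hp₁ hp₂ i j).2.2.1 k h
    · rcases cross i k j hk hj with h' | h' <;> simp [h']
    · rcases cross i j k hj hk with h' | h' <;> simp [h']
    · exact (one g hq₁ hq₂ i j).2.2.1 k h
  · rw [interpolation_mul_apply hfg, interpolation_mul_apply hfg]
    split_ifs
    · exact (one f hp₁ hp₂ i j).2.2.2 k h
    · exact (one g hq₁ hq₂ i j).2.2.2 k h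

end Schmidt

/-- The witnesses project onto the lines spanned by `(1, 0)` and `(1, 1)`. -/
theorem exists_isStarProjection_not_commute :
    ∃ p q : Matrix (Fin 2) (Fin 2) ℂ, IsStarProjection p ∧ IsStarProjection q ∧ p * q ≠ q * p := by
  refine ⟨!![1, 0; 0, 0], !![1 / 2, 1 / 2; 1 / 2, 1 / 2], ⟨?_, ?_⟩, ⟨?_, ?_⟩, ?_⟩
  · ext i j; fin_cases i <;> fin_cases j <;> simp [Matrix.mul_apply]
  · ext i j; fin_cases i <;> fin_cases j <;> simp [Matrix.star_apply]
  · ext i j; fin_cases i <;> fin_cases j <;> norm_num [Matrix.mul_apply]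
  · ext i j; fin_cases i <;> fin_cases j <;> simp [Matrix.star_apply]
  · intro h
    have := congrFun (congrFun h 0) 1
    norm_num [Matrix.mul_apply] at this

/-- The universal property sends a generator at a point moved by `f` to `p` and one at a point moved
by `g` to `q`; since `p` and `q` do not commute, neither do the generators. -/
theorem hasQuantumSymmetry_of_schmidtCriterion {V : Type u} [Fintype V] {G : SimpleGraph V}
    (h : SchmidtCriterion G) : HasQuantumSymmetry G := by
  obtain ⟨f, g, hf, hg, hd⟩ := h
  obtain ⟨p, q, hp, hq, hpq⟩ := exists_isStarProjection_not_commute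
  have hfg : ∀ x, f.toEquiv x = x ∨ g.toEquiv x = x := by
    intro x
    by_contra hx
    rw [not_or] at hx
    exact Set.disjoint_left.mp hd hx.1 hx.2
  have moved : ∀ f : G ≃g G, f ≠ SimpleGraph.Iso.refl → ∃ x, f.toEquiv x ≠ x := by
    intro f hf
    by_contra hx
    push Not at hx
    exact hf (RelIso.ext hx)
  obtain ⟨x, hx⟩ := moved f hf
  obtain ⟨y, hy⟩ := moved g hg
  have hadj : interpolation f.toEquiv p * interpolation g.toEquiv q * adj G _ =
      adj G _ * (interpolation f.toEquiv p * interpolation g.toEquiv q) := by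
    rw [mul_assoc, interpolation_mul_adj, ← mul_assoc, interpolation_mul_adj, mul_assoc]
  let χ := coeffLift _ (interpolation_mul_isMagic hfg hp hq) hadj
  have h₁ : χ ((Qu G).p (f.toEquiv x) x) = p := by
    rw [coeffLift_p, interpolation_mul_apply hfg, if_pos ((hfg x).resolve_left hx)]
    exact interpolation_apply_self p hx
  have h₂ : χ ((Qu G).p (g.toEquiv y) y) = q := by
    rw [coeffLift_p, interpolation_mul_apply hfg, if_neg hy]
    exact interpolation_apply_self q hy
  refine ⟨(Qu G).p (f.toEquiv x) x, (Qu G).p (g.toEquiv y) y, fun h => hpq ?_⟩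
  rw [← h₁, ← h₂, ← map_mul, h, map_mul]

end QuantumGraph

end

/-- The class of forests is tractable. -/
theorem mainTheorem1 : QuantumGraph.IsTractable.{u, w} QuantumGraph.forests.{u} := by
  open QuantumGraph in
  refine ⟨fun V _ G hG => ⟨fun h => ?_, isAsymmetric_of_isTrivial⟩,
    fun V W _ _ G H hG hH => ⟨?_, fun ⟨f⟩ => quantumIsomorphic_of_iso f⟩,
    fun V _ G hG => ⟨fun h => ?_, hasQuantumSymmetry_of_schmidtCriterion⟩⟩
  · classical
    refine isTrivial_of_forall_p fun i j => ?_
    rw [(isIntertwiner_p G).eq_one_of_isAsymmetric hG h, Matrix.one_apply]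
    split_ifs
    · exact Or.inr rfl
    · exact Or.inl rfl
  · rintro ⟨X, _, _, P, hP, hadj⟩
    exact (IsIntertwiner.of_mul_adj hP.isMagicMatrix hadj).nonempty_iso hG hH hP.card_eq.symm
  · by_contra hS
    exact not_hasQuantumSymmetry_of_commute
      ((isIntertwiner_p G).commute_of_not_schmidtCriterion hG hS) h
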